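/- Let $n\ge 1$ and $k\ge 0$ be integers. In $\mathbb C[y_1,\dots,y_n]^{S_n}=\mathbb C[e_1,\dots,e_n]$ let $e_r$, $h_r$, $p_r$ be the elementary, complete symmetric and power sum polynomials in $y_1,\dots,y_n$, and for $\lambda=(\lambda_1\ge\dots\ge\lambda_n\ge 0)$ let $s_\lambda$ be the Schur polynomial, i.e. the sum of the monomials $\prod_c y_{T(c)}$ over semistandard tableaux $T$ of shape $\lambda$ with entries in $\{1,\dots,n\}$. Let $P_k^+$ be the set of dominant integral weights of level $k$ of $\widehat{\mathfrak{su}}(n)$, i.e. of tuples $\hat\lambda=(m_1,\dots,m_n)\in\mathbb Z_{\ge0}^n$ with $\sum_i m_i=k$; such a weight corresponds to the partition $\lambda$ with $\lambda_i-\lambda_{i+1}=m_i$ for $1\le i\le n-1$ and $\lambda_n=0$. Let $S$ be the matrix over $P_k^+$ given by $$S_{\hat\lambda\hat\sigma}=\frac{e^{i\pi n(n-1)/4}}{\sqrt{n(k+n)^{n-1}}}\sum_{w\in S_n}\operatorname{sgn}(w)\,e^{-\frac{2\pi i}{k+n}(\sigma+\rho,\,w(\lambda+\rho))},$$ where $\rho$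 is the Weyl vector of $\mathfrak{su}(n)$, $\lambda,\sigma$ are viewed as weights of $\mathfrak{su}(n)$, and $(\cdot,\cdot)$ is the standard invariant form. Put $$\mathcal N_{\hat\lambda\hat\mu}^{\hat\nu}=\sum_{\hat\sigma\in P_k^+}\frac{S_{\hat\lambda\hat\sigma}S_{\hat\mu\hat\sigma}S^{-1}_{\hat\nu\hat\sigma}}{S_{\hat\emptyset\hat\sigma}},$$ where $\hat\emptyset$ is the weight of the empty partition. These numbers are integers, and the free abelian group $\mathcal F_{n,k}$ on $P_k^+$ with the product $\hat\lambda*\hat\mu=\sum_{\hat\nu}\mathcal N_{\hat\lambda\hat\mu}^{\hat\nu}\,\hat\nu$ is an associative, commutative ring with unit $\hat\emptyset$ (the fusion ring). Moreover: 1. Let $I_{n,k}=\langle e_n-1,h_{k+1},\dots,h_{n+k-1}\rangle\subset\mathbb C[e_1,\dots,e_n]$. This is the ideal of Gepner's fusion potential $V_{n+k}=\frac1{n+k}\,p_{n+k}$ with the constraint $e_n=1$: $I_{n,k}$ is the ideal generated by $e_n-1$ and the partial derivatives $\partial V_{n+k}/\partial e_i$, $1\le i\le n-1$. 2. $I_{n,k}$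 coincides with the Goodman–Wenzl ideal, generated by $e_n-1$ and all $s_\lambda$ with $\lambda=(\lambda_1\ge\dots\ge\lambda_n\ge0)$ and $\lambda_1-\lambda_n=k+1$. 3. The map $P_k^+\ni\hat\lambda\mapsto s_\lambda+I_{n,k}$ extends to an isomorphism of unital $\mathbb C$-algebras $$\mathcal F_{n,k}\otimes_{\mathbb Z}\mathbb C\;\cong\;\mathbb C[e_1,\dots,e_n]/I_{n,k}.$$ -/

import Mathlib

open scoped TensorProduct

noncomputable section

namespace SuFusion

/-! ### Dominant integral weights of level `k`, partitions, the modular `S`-matrix -/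

/-- `P_k^+`: dominant integral weights of level `k` of affine `su(n)`, given by their Dynkin labels
`(m_1, …, m_n)` with `m_1 + ⋯ + m_n = k`. The label `m_{i+1}` is `m i`; the last one belongs to the
affine node. -/
def Weight (n k : ℕ) : Type := {m : Fin n → ℕ // ∑ i, m i = k}

instance (n k : ℕ) : DecidableEq (Weight n k) :=
  inferInstanceAs (DecidableEq {m : Fin n → ℕ // ∑ i, m i = k})

instance (n k : ℕ) : Fintype (Weight n k) :=
  Fintype.subtype (Finset.Nat.antidiagonalTuple n k)
    (fun _ => Finset.Nat.mem_antidiagonalTuple)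

/-- The partition of a weight, written with `n` parts, the last one being `0`:
`λ_i - λ_{i+1} = m_i` for `1 ≤ i ≤ n - 1` and `λ_n = 0`. -/
def Weight.part {n k : ℕ} (m : Weight n k) (i : Fin n) : ℕ :=
  ∑ j : Fin n, if i ≤ j ∧ (j : ℕ) + 1 < n then m.1 j else 0

/-- The weight of the empty partition: `k` times the fundamental weight of the affine node. -/
def Weight.vac (n k : ℕ) [NeZero n] : Weight n k :=
  ⟨Pi.single ⊤ k, by simp⟩

/-- `λ + ρ`, for the finite part `λ` of a weight, as a vector with `n` coordinates of sum zero;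
there the invariant form is the dot product and the Weyl group `S_n` permutes the coordinates. -/
def Weight.shifted {n k : ℕ} (m : Weight n k) (i : Fin n) : ℝ :=
  ((m.part i : ℝ) - (∑ j, (m.part j : ℝ)) / n) + (((n : ℝ) - 1) / 2 - (i : ℕ))

/-- The modular `S`-matrix, by the Kac–Peterson formula. -/
def modS (n k : ℕ) : Matrix (Weight n k) (Weight n k) ℂ := fun l s =>
  Complex.exp (Complex.I * Real.pi * n * (n - 1) / 4) /
      (Real.sqrt ((n : ℝ) * ((k : ℝ) + n) ^ (n - 1)) : ℝ) *
    ∑ w : Equiv.Perm (Fin n), ((Equiv.Perm.sign w : ℤ) : ℂ) *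
      Complex.exp (-(2 * Real.pi * Complex.I / ((k : ℂ) + n)) *
        ((∑ i, s.shifted i * l.shifted (w i) : ℝ) : ℂ))

/-- The right-hand side of the Verlinde formula. -/
def verlinde (n k : ℕ) [NeZero n] (l m r : Weight n k) : ℂ :=
  ∑ s : Weight n k, modS n k l s * modS n k m s * (modS n k)⁻¹ r s / modS n k (Weight.vac n k) s

/-- The fusion coefficients as integers: the integer nearest to the value of the Verlinde formula.
(That the two agree exactly is part of the theorem.) -/
def fusionCoeff (n k : ℕ) [NeZero n] (l m r : Weight n k) : ℤ := round (verlinde n k l m r).re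

/-! ### The fusion ring -/

/-- The free abelian group on `P_k^+`. -/
def FusionRing (n k : ℕ) : Type := Weight n k →₀ ℤ

instance (n k : ℕ) : AddCommGroup (FusionRing n k) :=
  inferInstanceAs (AddCommGroup (Weight n k →₀ ℤ))

/-- The basis element of a weight. -/
def FusionRing.of {n k : ℕ} (m : Weight n k) : FusionRing n k := Finsupp.single m (1 : ℤ)

/-- The coefficient of an element at a weight. -/
def FusionRing.coeff {n k : ℕ} (x : FusionRing n k) (m : Weight n k) : ℤ :=
  DFunLike.coe (F := Weight n k →₀ ℤ) x m

/-- The fusion product: the bi-additive extension of `l * m = ∑ r, N_{l m}^r r`. -/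
def FusionRing.mul {n k : ℕ} [NeZero n] (x y : FusionRing n k) : FusionRing n k :=
  ∑ l : Weight n k, ∑ m : Weight n k, ∑ r : Weight n k,
    (x.coeff l * y.coeff m * fusionCoeff n k l m r) • FusionRing.of r

instance (n k : ℕ) [NeZero n] : Mul (FusionRing n k) := ⟨FusionRing.mul⟩

instance (n k : ℕ) [NeZero n] : One (FusionRing n k) := ⟨FusionRing.of (Weight.vac n k)⟩

theorem FusionRing.coeff_add {n k : ℕ} (x y : FusionRing n k) (m : Weight n k) :
    (x + y).coeff m = x.coeff m + y.coeff m := rfl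

theorem FusionRing.coeff_zero {n k : ℕ} (m : Weight n k) :
    (0 : FusionRing n k).coeff m = 0 := rfl

instance (n k : ℕ) [NeZero n] : NonUnitalNonAssocRing (FusionRing n k) where
  left_distrib x y z := by
    change FusionRing.mul _ _ = FusionRing.mul _ _ + FusionRing.mul _ _
    simp only [FusionRing.mul, FusionRing.coeff_add, mul_add, add_mul, add_smul,
      Finset.sum_add_distrib]
  right_distrib x y z := by
    change FusionRing.mul _ _ = FusionRing.mul _ _ + FusionRing.mul _ _
    simp only [FusionRing.mul, FusionRing.coeff_add, add_mul, add_smul, Finset.sum_add_distrib]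
  zero_mul x := by
    change FusionRing.mul _ _ = _
    simp [FusionRing.mul, FusionRing.coeff_zero]
  mul_zero x := by
    change FusionRing.mul _ _ = _
    simp [FusionRing.mul, FusionRing.coeff_zero]

/-! ### Symmetric polynomials in `y_1, …, y_n` as elements of `ℂ[e_1, …, e_n]` -/

/-- The polynomial ring `ℂ[e_1, …, e_n]`; the variable `X i` is `e_{i+1}`. -/
abbrev ERing (n : ℕ) : Type := MvPolynomial (Fin n) ℂ

/-- The isomorphism of `ℂ[e_1, …, e_n]` with the symmetric polynomials in `y_1, …, y_n`. -/
abbrev toSym (n : ℕ) : ERing n ≃ₐ[ℂ] MvPolynomial.symmetricSubalgebra (Fin n) ℂ :=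
  MvPolynomial.esymmAlgEquiv (Fin n) ℂ (Fintype.card_fin n)

/-- `e_r` as an element of `ℂ[e_1, …, e_n]`. -/
def e (n r : ℕ) : ERing n :=
  (toSym n).symm ⟨MvPolynomial.esymm (Fin n) ℂ r, MvPolynomial.esymm_isSymmetric _ _ r⟩

/-- The complete symmetric polynomial `h_r` as an element of `ℂ[e_1, …, e_n]`. -/
def h (n r : ℕ) : ERing n :=
  (toSym n).symm ⟨MvPolynomial.hsymm (Fin n) ℂ r, MvPolynomial.hsymm_isSymmetric _ _ r⟩

/-- The power sum `p_r` as an element of `ℂ[e_1, …, e_n]`. -/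
def p (n r : ℕ) : ERing n :=
  (toSym n).symm ⟨MvPolynomial.psum (Fin n) ℂ r, MvPolynomial.psum_isSymmetric _ _ r⟩

/-- A filling of the boxes of the diagram of `lam` (row `i` has `lam i` boxes) with entries in
`{1, …, n}` is a semistandard tableau: rows increase weakly, columns increase strictly. -/
def IsSemistandard {n : ℕ} (lam : Fin n → ℕ) (T : (Σ i : Fin n, Fin (lam i)) → Fin n) : Prop :=
  (∀ (i : Fin n) (a b : Fin (lam i)), a ≤ b → T ⟨i, a⟩ ≤ T ⟨i, b⟩) ∧
  (∀ (i j : Fin n) (a : Fin (lam i)) (b : Fin (lam j)),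
    i < j → (a : ℕ) = (b : ℕ) → T ⟨i, a⟩ < T ⟨j, b⟩)

open Classical in
/-- The Schur polynomial `s_λ(y_1, …, y_n)` as the weighted sum of semistandard tableaux. -/
def schur {n : ℕ} (lam : Fin n → ℕ) : MvPolynomial (Fin n) ℂ :=
  ∑ T : (Σ i : Fin n, Fin (lam i)) → Fin n with IsSemistandard lam T,
    ∏ c : Σ i : Fin n, Fin (lam i), MvPolynomial.X (T c)

/-- `q` is the Schur polynomial `s_λ` written as a polynomial in `e_1, …, e_n`. -/
def IsSchur {n : ℕ} (lam : Fin n → ℕ) (q : ERing n) : Prop :=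
  ((toSym n q : MvPolynomial.symmetricSubalgebra (Fin n) ℂ) : MvPolynomial (Fin n) ℂ) = schur lam

/-! ### The ideals -/

/-- `I_{n,k} = ⟨e_n - 1, h_{k+1}, …, h_{n+k-1}⟩`. -/
def gepnerIdeal (n k : ℕ) : Ideal (ERing n) :=
  Ideal.span (insert (e n n - 1) {q | ∃ r : ℕ, k + 1 ≤ r ∧ r + 1 ≤ n + k ∧ q = h n r})

/-- Gepner's fusion potential `V_{n+k} = p_{n+k} / (n+k)` as a polynomial in `e_1, …, e_n`. -/
def gepnerPotential (n k : ℕ) : ERing n :=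
  MvPolynomial.C (1 / ((n : ℂ) + k)) * p n (n + k)

/-- The ideal resulting from Gepner's potential: it is generated by `e_n - 1` and the partial
derivatives `∂V_{n+k}/∂e_i`, `i = 1, …, n - 1`. -/
def potentialIdeal (n k : ℕ) : Ideal (ERing n) :=
  Ideal.span (insert (e n n - 1)
    {q | ∃ i : Fin n, (i : ℕ) + 1 < n ∧ q = MvPolynomial.pderiv i (gepnerPotential n k)})

/-- The ideal of Goodman and Wenzl (with `e_n = 1`): it is generated by `e_n - 1` and all `s_λ` with
`λ = (λ_1 ≥ ⋯ ≥ λ_n)` and `λ_1 - λ_n = k + 1`. -/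
def goodmanWenzlIdeal (n k : ℕ) [NeZero n] : Ideal (ERing n) :=
  Ideal.span (insert (e n n - 1)
    {q | ∃ lam : Fin n → ℕ, Antitone lam ∧ lam 0 = lam ⊤ + (k + 1) ∧ IsSchur lam q})

end SuFusion

end

/-!
By the bialternant formula `s_λ` is the quotient of the alternants of `λ + ρ` and `ρ`. Put
`N = n + k`. Modulo `I_{n,k}` one has `h_{N+r} = h_N h_r`, so the Jacobi–Trudi determinants
alternate under the affine Weyl group of level `N`: each of them is `0` or plus or minus the class
of the Schur polynomial of a weight of level `k`. Hence these classes span the quotient, and their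
products have integral coordinates.

Conversely, the points with coordinates `exp (-2πi (σ + ρ)_j / N)`, one for each weight `σ`, are
distinct zeros of `I_{n,k}`. Their evaluations are linearly independent characters of the quotient,
so the classes form a basis. The matrix of their values at the points is, up to scaling the columns,
the modular matrix `S`, so the points diagonalise multiplication by the basis and Verlinde's formula
computes its structure constants.
-/

noncomputable section

namespace SuFusion

/-! ### Generating series of elementary and complete symmetric polynomials -/

section GeneratingSeries

open PowerSeries

variable {R ι : Type*} [CommRing R]

/-- The generating series `∏ i ∈ s, (1 - y_i X)⁻¹` of the values at `y` of the complete symmetric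
polynomials. -/
def hSeries (s : Finset ι) (y : ι → R) : R⟦X⟧ := ∏ i ∈ s, PowerSeries.mk (y i ^ ·)

/-- The generating series `∏ i ∈ s, (1 - y_i X)` of the values at `y` of the elementary symmetric
polynomials, the `r`-th one with the sign `(-1) ^ r`. -/
def eSeries (s : Finset ι) (y : ι → R) : R⟦X⟧ := ∏ i ∈ s, (1 - C (y i) * X)

/-- The value at `y` of the complete symmetric polynomial of degree `r`, which is `0` for
negative `r`. -/
def hVal [Fintype ι] (y : ι → R) (r : ℤ) : R :=
  if r < 0 then 0 else coeff r.toNat (hSeries Finset.univ y)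

theorem one_sub_mul_mk_pow (a : R) : (1 - C a * X) * PowerSeries.mk (a ^ ·) = 1 := by
  ext r
  rw [sub_mul, one_mul, map_sub, mul_assoc, coeff_C_mul]
  cases r with
  | zero => simp
  | succ r => simp [coeff_succ_X_mul, coeff_one, pow_succ']

theorem eSeries_mul_hSeries (s : Finset ι) (y : ι → R) : eSeries s y * hSeries s y = 1 := by
  rw [eSeries, hSeries, ← Finset.prod_mul_distrib]
  exact Finset.prod_eq_one fun i _ => one_sub_mul_mk_pow _

theorem eSeries_erase_mul_hSeries [Fintype ι] [DecidableEq ι] (y : ι → R) (l : ι) :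
    eSeries (Finset.univ.erase l) y * hSeries Finset.univ y = PowerSeries.mk (y l ^ ·) := by
  rw [hSeries, ← Finset.mul_prod_erase Finset.univ _ (Finset.mem_univ l), mul_left_comm,
    ← hSeries, eSeries_mul_hSeries, mul_one]

theorem coeff_eSeries (s : Finset ι) (y : ι → R) (r : ℕ) :
    coeff r (eSeries s y) = (-1) ^ r * ∑ t ∈ s.powersetCard r, ∏ i ∈ t, y i := by
  classical
  have expand : eSeries s y = ∑ t ∈ s.powerset, C ((-1) ^ t.card * ∏ i ∈ t, y i) * X ^ t.card := by
    simp only [eSeries, sub_eq_add_neg, Finset.prod_one_add, Finset.prod_neg,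
      Finset.prod_mul_distrib, Finset.prod_const, map_mul, map_pow, map_neg, map_one, map_prod,
      mul_assoc]
  rw [expand, map_sum, Finset.mul_sum, Finset.powersetCard_eq_filter, Finset.sum_filter]
  refine Finset.sum_congr rfl fun t _ => ?_
  rw [coeff_C_mul, coeff_X_pow]
  rcases eq_or_ne t.card r with h | h
  · simp [h]
  · simp [h, h.symm]

theorem coeff_eSeries_eq_zero (s : Finset ι) (y : ι → R) {r : ℕ} (h : s.card < r) :
    coeff r (eSeries s y) = 0 := by
  rw [coeff_eSeries, Finset.powersetCard_eq_empty.2 h, Finset.sum_empty, mul_zero]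

theorem coeff_zero_eSeries (s : Finset ι) (y : ι → R) : coeff 0 (eSeries s y) = 1 := by
  simp [coeff_eSeries]

variable [Fintype ι]

theorem hVal_of_neg (y : ι → R) {r : ℤ} (h : r < 0) : hVal y r = 0 := if_pos h

theorem hVal_natCast (y : ι → R) (r : ℕ) : hVal y r = coeff r (hSeries Finset.univ y) := by
  simp [hVal]

theorem hVal_zero (y : ι → R) : hVal y 0 = 1 := by
  simpa [hSeries, map_prod] using hVal_natCast y 0

theorem map_hVal {S : Type*} [CommRing S] (f : R →+* S) (y : ι → R) (r : ℤ) :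
    f (hVal y r) = hVal (fun i => f (y i)) r := by
  have map_hSeries : hSeries Finset.univ (fun i => f (y i)) =
      PowerSeries.map f (hSeries Finset.univ y) := by
    simp only [hSeries, map_prod]
    exact Finset.prod_congr rfl fun i _ => by ext; simp
  unfold hVal
  split_ifs
  · exact map_zero f
  · rw [map_hSeries, coeff_map]

theorem sum_coeff_mul_hVal (y : ι → R) {P : R⟦X⟧} {d : ℕ} (hP : ∀ i, d ≤ i → coeff i P = 0)
    (r : ℕ) : ∑ i ∈ Finset.range d, coeff i P * hVal y ((r : ℤ) - i) =
      coeff r (P * hSeries Finset.univ y) := by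
  rw [coeff_mul, Finset.Nat.sum_antidiagonal_eq_sum_range_succ
    (fun i j => coeff i P * coeff j (hSeries Finset.univ y))]
  have term (i : ℕ) (hi : i ∈ Finset.range (r + 1)) :
      coeff i P * coeff (r - i) (hSeries Finset.univ y) = coeff i P * hVal y ((r : ℤ) - i) := by
    rw [← Nat.cast_sub (Finset.mem_range_succ_iff.1 hi), hVal_natCast]
  rw [Finset.sum_congr rfl term]
  apply Finset.sum_congr_of_eq_on_inter
  · intro i _ hi
    rw [hVal_of_neg y (by rw [Finset.mem_range] at hi; omega), mul_zero]
  · intro i _ hi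
    rw [hP i (by simpa using hi), zero_mul]
  · exact fun i _ _ => rfl

theorem aeval_esymm {A : Type*} [CommRing A] [Algebra A R] (y : ι → R) (r : ℕ) :
    MvPolynomial.aeval y (MvPolynomial.esymm ι A r) =
      (-1) ^ r * coeff r (eSeries Finset.univ y) := by
  rw [coeff_eSeries, ← mul_assoc, ← pow_add, Even.neg_one_pow ⟨r, rfl⟩, one_mul,
    MvPolynomial.esymm, map_sum]
  simp only [map_prod, MvPolynomial.aeval_X]

theorem aeval_hsymm {A : Type*} [CommRing A] [Algebra A R] [DecidableEq ι] (y : ι → R) (r : ℕ) :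
    MvPolynomial.aeval y (MvPolynomial.hsymm ι A r) = hVal y r := by
  have monomial_eq (s : Sym ι r) : MvPolynomial.aeval y (s.1.map (MvPolynomial.X (R := A))).prod =
      ∏ i, y i ^ s.1.count i := by
    rw [map_multiset_prod, Multiset.map_map]
    simp only [Function.comp_def, MvPolynomial.aeval_X, Finset.prod_multiset_map_count]
    exact Finset.prod_subset (Finset.subset_univ _) fun i _ hi => by
      rw [Multiset.count_eq_zero.2 (mt Multiset.mem_toFinset.2 hi), pow_zero]
  rw [hVal_natCast, hSeries, coeff_prod, MvPolynomial.hsymm, map_sum]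
  simp only [monomial_eq, coeff_mk]
  refine Finset.sum_bij' (fun s _ => Multiset.toFinsupp s.1)
    (fun f hf => ⟨Finsupp.toMultiset f, ?_⟩) ?_ ?_ ?_ ?_ ?_
  · rw [Finset.mem_finsuppAntidiag] at hf
    rw [Finsupp.card_toMultiset, Finsupp.sum_fintype _ _ (fun _ => rfl)]
    exact hf.1
  · intro s _
    rw [Finset.mem_finsuppAntidiag]
    exact ⟨(Multiset.sum_count_eq_card (by simp)).trans s.2, Finset.subset_univ _⟩
  · exact fun f _ => Finset.mem_univ _
  · exact fun s _ => Subtype.ext (by simp)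
  · exact fun f _ => by simp
  · exact fun s _ => by simp

theorem hVal_castSucc {m : ℕ} (y : Fin (m + 1) → R) (r : ℤ) :
    hVal y r = hVal (fun i => y (Fin.castSucc i)) r + y (Fin.last m) * hVal y (r - 1) := by
  have hSeries_castSucc : hSeries Finset.univ y * (1 - C (y (Fin.last m)) * X) =
      hSeries Finset.univ (fun i => y (Fin.castSucc i)) := by
    rw [hSeries, Fin.prod_univ_castSucc, mul_assoc, mul_comm (PowerSeries.mk _),
      one_sub_mul_mk_pow, mul_one, hSeries]
  rcases lt_trichotomy r 0 with h | rfl | h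
  · rw [hVal_of_neg _ h, hVal_of_neg _ h, hVal_of_neg _ (by omega), mul_zero, add_zero]
  · rw [hVal_zero, hVal_zero, hVal_of_neg _ (by omega), mul_zero, add_zero]
  · lift r to ℕ using h.le
    obtain ⟨r, rfl⟩ := Nat.exists_eq_succ_of_ne_zero (Nat.cast_pos.1 h).ne'
    have coeff_eq := congrArg (coeff (r + 1)) hSeries_castSucc
    rw [mul_sub, mul_one, map_sub, mul_comm, mul_assoc, coeff_C_mul, coeff_succ_X_mul] at coeff_eq
    rw [Nat.cast_succ, add_sub_cancel_right, ← Nat.cast_succ, hVal_natCast, hVal_natCast,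
      hVal_natCast, ← coeff_eq]
    ring

theorem hVal_add_eq_sum_Icc {m : ℕ} (y : Fin (m + 1) → R) (t : ℤ) {p q : ℕ} (hpq : p ≤ q) :
    hVal y (q + t) = y (Fin.last m) ^ (q - p + 1) * hVal y (p + t - 1) +
      ∑ b ∈ Finset.Icc p q, y (Fin.last m) ^ (q - b) *
        hVal (fun i => y (Fin.castSucc i)) (b + t) := by
  induction q, hpq using Nat.le_induction with
  | base =>
    rw [Finset.Icc_self, Finset.sum_singleton, Nat.sub_self, zero_add, pow_one, pow_zero, one_mul,
      hVal_castSucc, add_comm]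
  | succ q hpq ih =>
    have shift (b : ℕ) (hb : b ∈ Finset.Icc p q) :
        y (Fin.last m) ^ (q + 1 - b) * hVal (fun i => y (Fin.castSucc i)) (b + t) =
        y (Fin.last m) * (y (Fin.last m) ^ (q - b) *
          hVal (fun i => y (Fin.castSucc i)) (b + t)) := by
      rw [Nat.sub_add_comm (Finset.mem_Icc.1 hb).2, pow_succ']
      ring
    rw [Finset.sum_Icc_succ_top (hpq.trans q.le_succ), Finset.sum_congr rfl shift,
      ← Finset.mul_sum, hVal_castSucc, Nat.cast_succ, add_right_comm, add_sub_cancel_right, ih,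
      Nat.sub_add_comm hpq, Nat.sub_self]
    ring

end GeneratingSeries

/-! ### Tableaux and the Jacobi–Trudi identity -/

section Tableau

variable {n m : ℕ}

/-- Semistandard tableaux of shape `lam` with entries in an alphabet of `m` letters. The size of the
alphabet is independent of the number of rows, so that the last letter can be removed. -/
def IsTableau (lam : Fin n → ℕ) (T : (Σ i : Fin n, Fin (lam i)) → Fin m) : Prop :=
  (∀ (i : Fin n) (a b : Fin (lam i)), a ≤ b → T ⟨i, a⟩ ≤ T ⟨i, b⟩) ∧
  (∀ (i j : Fin n) (a : Fin (lam i)) (b : Fin (lam j)),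
    i < j → (a : ℕ) = (b : ℕ) → T ⟨i, a⟩ < T ⟨j, b⟩)

open Classical in
/-- The Schur polynomial of `lam` in `m` variables, as a sum over tableaux, evaluated at `y`. -/
def tableauSum {R : Type*} [CommSemiring R] (lam : Fin n → ℕ) (y : Fin m → R) : R :=
  ∑ T : (Σ i : Fin n, Fin (lam i)) → Fin m with IsTableau lam T, ∏ c, y (T c)

theorem schur_eq_tableauSum (lam : Fin n → ℕ) :
    schur lam = tableauSum lam (MvPolynomial.X : Fin n → MvPolynomial (Fin n) ℂ) := rfl

/-- The part of `lam` after the `i`-th one, which is `0` for the last `i`. -/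
def nextPart (lam : Fin n → ℕ) (i : Fin n) : ℕ :=
  if h : (i : ℕ) + 1 < n then lam ⟨i + 1, h⟩ else 0

/-- The `mu` such that `lam / mu` is a horizontal strip: the parts of `mu` interlace with those of
`lam`. -/
def interlacing (lam : Fin n → ℕ) : Finset (Fin n → ℕ) :=
  Fintype.piFinset fun i => Finset.Icc (nextPart lam i) (lam i)

theorem mem_interlacing {lam mu : Fin n → ℕ} :
    mu ∈ interlacing lam ↔ ∀ i, nextPart lam i ≤ mu i ∧ mu i ≤ lam i := by
  simp [interlacing]

theorem le_nextPart {lam : Fin n → ℕ} (hl : Antitone lam) {i j : Fin n} (h : i < j) :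
    lam j ≤ nextPart lam i := by
  have hi : (i : ℕ) + 1 < n := lt_of_le_of_lt (Nat.succ_le_of_lt h) j.2
  rw [nextPart, dif_pos hi]
  exact hl (show (⟨i + 1, hi⟩ : Fin n) ≤ j from h)

theorem nextPart_le {lam : Fin n → ℕ} (hl : Antitone lam) (i : Fin n) :
    nextPart lam i ≤ lam i := by
  unfold nextPart
  split_ifs with h
  · exact hl (show (i : ℕ) ≤ i + 1 from Nat.le_succ _)
  · exact Nat.zero_le _

theorem antitone_of_mem_interlacing {lam mu : Fin n → ℕ} (hl : Antitone lam)
    (h : mu ∈ interlacing lam) : Antitone mu := by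
  rw [mem_interlacing] at h
  intro i j hij
  rcases hij.eq_or_lt with rfl | hij
  · exact le_rfl
  · exact ((h j).2.trans (le_nextPart hl hij)).trans (h i).1

theorem lt_card_filter_iff {N : ℕ} {p : Fin N → Prop} [DecidablePred p]
    (hp : ∀ a b, a ≤ b → p b → p a) (a : Fin N) :
    (a : ℕ) < (Finset.univ.filter p).card ↔ p a := by
  constructor
  · contrapose!
    intro ha
    rw [← Fin.card_Iio]
    refine Finset.card_le_card fun b hb => Finset.mem_Iio.2 (not_le.1 fun hab => ha ?_)
    exact hp a b hab (Finset.mem_filter.1 hb).2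
  · intro ha
    rw [← Nat.add_one_le_iff, ← Fin.card_Iic]
    exact Finset.card_le_card fun b hb =>
      Finset.mem_filter.2 ⟨Finset.mem_univ b, hp b a (Finset.mem_Iic.1 hb) ha⟩

/-- The tableau of shape `lam` that is `T` on the diagram of `mu` and has the last letter in the
other boxes. -/
def extendFilling (lam mu : Fin n → ℕ) (T : (Σ i : Fin n, Fin (mu i)) → Fin m) :
    (Σ i : Fin n, Fin (lam i)) → Fin (m + 1) := fun c =>
  if h : (c.2 : ℕ) < mu c.1 then Fin.castSucc (T ⟨c.1, ⟨c.2, h⟩⟩) else Fin.last m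

/-- The shape of the boxes of `T` that do not hold the last letter. -/
def innerShape (lam : Fin n → ℕ) (T : (Σ i : Fin n, Fin (lam i)) → Fin (m + 1)) (i : Fin n) : ℕ :=
  (Finset.univ.filter fun a : Fin (lam i) => T ⟨i, a⟩ ≠ Fin.last m).card

section
variable {lam : Fin n → ℕ} {T : (Σ i : Fin n, Fin (lam i)) → Fin (m + 1)}

theorem innerShape_le (i : Fin n) : innerShape lam T i ≤ lam i :=
  (Finset.card_filter_le _ _).trans (by simp)

theorem lt_innerShape_iff (hT : IsTableau lam T) (i : Fin n) (a : Fin (lam i)) :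
    (a : ℕ) < innerShape lam T i ↔ T ⟨i, a⟩ ≠ Fin.last m :=
  lt_card_filter_iff (p := fun a => T ⟨i, a⟩ ≠ Fin.last m)
    (fun a b hab hb ha => hb (Fin.last_le_iff.1 (ha ▸ hT.1 i a b hab))) a

theorem innerShape_mem_interlacing (hl : Antitone lam) (hT : IsTableau lam T) :
    innerShape lam T ∈ interlacing lam := by
  refine mem_interlacing.2 fun i => ⟨?_, innerShape_le i⟩
  by_contra! hlt
  have hi : (i : ℕ) + 1 < n := by
    by_contra hi
    rw [nextPart, dif_neg hi] at hlt
    exact absurd hlt (Nat.not_lt_zero _)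
  have hlt' := hlt.trans_le (nextPart_le hl i)
  have last_above : T ⟨i, ⟨innerShape lam T i, hlt'⟩⟩ = Fin.last m :=
    not_not.1 fun h => lt_irrefl _ ((lt_innerShape_iff hT i ⟨_, hlt'⟩).2 h)
  rw [nextPart, dif_pos hi] at hlt
  have column_lt := hT.2 i ⟨i + 1, hi⟩ ⟨innerShape lam T i, hlt'⟩ ⟨innerShape lam T i, hlt⟩
    (show (i : ℕ) < i + 1 from Nat.lt_succ_self _) rfl
  rw [last_above] at column_lt
  exact absurd (Fin.le_last _) (not_le.2 column_lt)

theorem exists_extendFilling_eq (hT : IsTableau lam T) :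
    ∃ T' : (Σ i : Fin n, Fin (innerShape lam T i)) → Fin m,
      IsTableau (innerShape lam T) T' ∧ extendFilling lam (innerShape lam T) T' = T := by
  have ne_last (c : Σ i : Fin n, Fin (innerShape lam T i)) :
      T ⟨c.1, c.2.castLE (innerShape_le c.1)⟩ ≠ Fin.last m :=
    (lt_innerShape_iff hT c.1 (c.2.castLE (innerShape_le c.1))).1 c.2.2
  refine ⟨fun c => Fin.castPred _ (ne_last c), ⟨fun i a b hab => ?_, fun i j a b hij hab => ?_⟩, ?_⟩
  · exact Fin.castPred_le_castPred_iff.2 (hT.1 _ _ _ hab)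
  · exact Fin.castPred_lt_castPred_iff.2 (hT.2 _ _ _ _ hij hab)
  · funext ⟨i, a⟩
    simp only [extendFilling]
    split_ifs with h
    · simp
    · rw [lt_innerShape_iff hT, not_not] at h
      exact h.symm

end

section
variable {lam mu : Fin n → ℕ} {T : (Σ i : Fin n, Fin (mu i)) → Fin m}

theorem isTableau_extendFilling (hl : Antitone lam) (hmu : mu ∈ interlacing lam)
    (hT : IsTableau mu T) : IsTableau lam (extendFilling lam mu T) := by
  constructor
  · intro i a b hab
    simp only [extendFilling]
    split_ifs with ha hb hb
    · exact Fin.castSucc_le_castSucc_iff.2 (hT.1 _ _ _ hab)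
    · exact Fin.le_last _
    · exact absurd (lt_of_le_of_lt (show (a : ℕ) ≤ b from hab) hb) ha
    · exact le_rfl
  · intro i j a b hij hab
    have ha : (a : ℕ) < mu i :=
      hab ▸ b.2.trans_le ((le_nextPart hl hij).trans (mem_interlacing.1 hmu i).1)
    simp only [extendFilling]
    rw [dif_pos ha]
    split_ifs with hb
    · exact Fin.castSucc_lt_castSucc_iff.2 (hT.2 _ _ _ _ hij hab)
    · exact Fin.castSucc_lt_last _

theorem innerShape_extendFilling (hl : Antitone lam) (hmu : mu ∈ interlacing lam)
    (hT : IsTableau mu T) : innerShape lam (extendFilling lam mu T) = mu := by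
  funext i
  have lt_iff (a : Fin (lam i)) :
      (a : ℕ) < innerShape lam (extendFilling lam mu T) i ↔ (a : ℕ) < mu i := by
    rw [lt_innerShape_iff (isTableau_extendFilling hl hmu hT)]
    simp only [extendFilling]
    split_ifs with h
    · simp [h, (Fin.castSucc_lt_last _).ne]
    · simp [h]
  rcases lt_trichotomy (innerShape lam (extendFilling lam mu T) i) (mu i) with h | h | h
  · exact absurd ((lt_iff ⟨_, h.trans_le (mem_interlacing.1 hmu i).2⟩).2 h) (lt_irrefl _)
  · exact h
  · exact absurd ((lt_iff ⟨_, h.trans_le (innerShape_le i)⟩).1 h) (lt_irrefl _)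

theorem extendFilling_injective (hmu : mu ∈ interlacing lam) :
    Function.Injective (extendFilling (m := m) lam mu) := by
  intro T T' h
  funext ⟨i, a⟩
  simpa [extendFilling] using congrFun h ⟨i, a.castLE (mem_interlacing.1 hmu i).2⟩

theorem prod_extendFilling {R : Type*} [CommSemiring R] (hmu : mu ∈ interlacing lam)
    (y : Fin (m + 1) → R) : ∏ c, y (extendFilling lam mu T c) =
      (∏ i, y (Fin.last m) ^ (lam i - mu i)) * ∏ c, y (Fin.castSucc (T c)) := by
  rw [Fintype.prod_sigma, Fintype.prod_sigma, ← Finset.prod_mul_distrib]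
  refine Finset.prod_congr rfl fun i _ => ?_
  obtain ⟨d, hd⟩ := Nat.exists_eq_add_of_le (mem_interlacing.1 hmu i).2
  rw [← (finCongr hd.symm).prod_comp, Fin.prod_univ_add]
  simp [extendFilling, hd, mul_comm]

end

theorem tableauSum_succ {R : Type*} [CommSemiring R] {lam : Fin n → ℕ} (hl : Antitone lam)
    (y : Fin (m + 1) → R) :
    tableauSum lam y = ∑ mu ∈ interlacing lam, (∏ i, y (Fin.last m) ^ (lam i - mu i)) *
      tableauSum mu (fun i => y (Fin.castSucc i)) := by
  classical
  rw [tableauSum, ← Finset.sum_fiberwise_of_maps_to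
    (fun T hT => innerShape_mem_interlacing hl (Finset.mem_filter.1 hT).2)]
  refine Finset.sum_congr rfl fun mu hmu => ?_
  rw [tableauSum, Finset.mul_sum]
  symm
  refine Finset.sum_bij (fun T _ => extendFilling lam mu T) (fun T hT => ?_)
    (fun T _ T' _ h => extendFilling_injective hmu h) (fun T hT => ?_)
    (fun T _ => (prod_extendFilling hmu y).symm)
  · replace hT := (Finset.mem_filter.1 hT).2
    simp only [Finset.mem_filter, Finset.mem_univ, true_and]
    exact ⟨isTableau_extendFilling hl hmu hT, innerShape_extendFilling hl hmu hT⟩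
  · simp only [Finset.mem_filter, Finset.mem_univ, true_and] at hT
    obtain ⟨hT, rfl⟩ := hT
    obtain ⟨T', hT', extend_eq⟩ := exists_extendFilling_eq hT
    exact ⟨T', Finset.mem_filter.2 ⟨Finset.mem_univ _, hT'⟩, extend_eq⟩

theorem tableauSum_zero {R : Type*} [CommSemiring R] (y : Fin m → R) :
    tableauSum (0 : Fin n → ℕ) y = 1 := by
  classical
  have : IsEmpty (Σ i : Fin n, Fin ((0 : Fin n → ℕ) i)) := ⟨fun c => Fin.elim0 c.2⟩
  rw [tableauSum, Finset.filter_true_of_mem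
    fun T _ => ⟨fun i a => Fin.elim0 a, fun i j a => Fin.elim0 a⟩]
  simp

theorem tableauSum_of_isEmpty {R : Type*} [CommSemiring R] {lam : Fin n → ℕ} (hl : lam ≠ 0)
    (y : Fin 0 → R) : tableauSum lam y = 0 := by
  obtain ⟨i, hi⟩ := Function.ne_iff.1 hl
  exact Finset.sum_eq_zero fun T _ => Fin.elim0 (T ⟨i, ⟨0, Nat.pos_of_ne_zero hi⟩⟩)

end Tableau

section JacobiTrudi

variable {R : Type*} [CommRing R] {n : ℕ}

/-- The staircase `(n - 1, …, 1, 0)`. -/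
def rho (n : ℕ) (i : Fin n) : ℕ := i.rev

/-- The Jacobi–Trudi determinant of a sequence `H`, indexed by `a = lam + rho` rather than by the
partition `lam`; as an alternating function of `a` it makes sense for all exponents. -/
def jacobiTrudi (H : ℤ → R) (a : Fin n → ℕ) : R :=
  Matrix.det (Matrix.of fun i j => H ((a i : ℤ) - rho n j))

theorem map_jacobiTrudi {S : Type*} [CommRing S] (f : R →+* S) (H : ℤ → R) (a : Fin n → ℕ) :
    f (jacobiTrudi H a) = jacobiTrudi (fun r => f (H r)) a := by
  rw [jacobiTrudi, f.map_det]
  rfl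

theorem jacobiTrudi_comp_perm (H : ℤ → R) (a : Fin n → ℕ) (w : Equiv.Perm (Fin n)) :
    jacobiTrudi H (a ∘ w) = (Equiv.Perm.sign w : ℤ) * jacobiTrudi H a :=
  Matrix.det_permute w (Matrix.of fun i j => H ((a i : ℤ) - rho n j))

theorem jacobiTrudi_of_not_injective (H : ℤ → R) {a : Fin n → ℕ} (ha : ¬ Function.Injective a) :
    jacobiTrudi H a = 0 := by
  obtain ⟨i, j, hij, hne⟩ := Function.not_injective_iff.1 ha
  exact Matrix.det_zero_of_row_eq hne (funext fun l => by simp only [Matrix.of_apply, hij])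

theorem jacobiTrudi_eq_prod {H : ℤ → R} {a : Fin n → ℕ}
    (ha : ∀ i j, j < i → H ((a i : ℤ) - rho n j) = 0) :
    jacobiTrudi H a = ∏ i, H ((a i : ℤ) - rho n i) :=
  Matrix.det_of_isUpperTriangular fun i j hij => ha i j hij

theorem jacobiTrudi_update {H : ℤ → R} {a : Fin n → ℕ} {i : Fin n} {b : ℕ} {c : R}
    (h : ∀ j, H ((b : ℤ) - rho n j) = c * H ((a i : ℤ) - rho n j)) :
    jacobiTrudi H (Function.update a i b) = c * jacobiTrudi H a := by
  have row_update : Matrix.of (fun l j => H ((Function.update a i b l : ℤ) - rho n j)) =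
      Matrix.updateRow (Matrix.of fun l j => H ((a l : ℤ) - rho n j)) i
        (c • fun j => H ((a i : ℤ) - rho n j)) := by
    ext l j
    rcases eq_or_ne l i with rfl | hl
    · simp [h]
    · simp [hl]
  rw [jacobiTrudi, row_update, Matrix.det_updateRow_smul]
  exact congrArg (c * Matrix.det ·) (Matrix.updateRow_eq_self _ i)

theorem jacobiTrudi_update_rho {H : ℤ → R} (hneg : ∀ r < 0, H r = 0) (h0 : H 0 = 1) {i : Fin n}
    {b : ℕ} (hb : ∀ j < i, H ((b : ℤ) - rho n j) = 0) :
    jacobiTrudi H (Function.update (rho n) i b) = H ((b : ℤ) - rho n i) := by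
  rw [jacobiTrudi_eq_prod, Fintype.prod_eq_single i, Function.update_self]
  · intro l hl
    rw [Function.update_of_ne hl, sub_self, h0]
  · intro l j hj
    rcases eq_or_ne l i with rfl | hl
    · rw [Function.update_self, hb j hj]
    · rw [Function.update_of_ne hl]
      refine hneg _ ?_
      simp only [rho, Fin.val_rev]
      omega

variable {m : ℕ} {lam : Fin n → ℕ}

theorem jacobiTrudi_eq_det_sum (hl : Antitone lam) (y : Fin (m + 1) → R) :
    jacobiTrudi (hVal y) (lam + rho n) =
      Matrix.det (Matrix.of fun i j => ∑ b ∈ Finset.Icc (nextPart lam i) (lam i),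
        y (Fin.last m) ^ (lam i - b) *
          hVal (fun l => y (Fin.castSucc l)) (((b + rho n i : ℕ) : ℤ) - rho n j)) := by
  let K : Matrix (Fin n) (Fin n) R := Matrix.of fun i l =>
    if (l : ℕ) = i + 1 then y (Fin.last m) ^ (lam i - nextPart lam i + 1) else 0
  have det_one_sub_K : (1 - K).det = 1 := by
    rw [Matrix.det_of_isUpperTriangular]
    · exact Finset.prod_eq_one fun i _ => by simp [K]
    · intro i j hij
      have hij : (j : ℕ) < i := hij
      rw [Matrix.sub_apply, Matrix.one_apply_ne (Fin.ne_of_gt hij), zero_sub, neg_eq_zero]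
      exact if_neg (by omega)
  have row_succ (i j : Fin n) :
      (K * Matrix.of fun i j => hVal y (((lam i + rho n i : ℕ) : ℤ) - rho n j)) i j =
        y (Fin.last m) ^ (lam i - nextPart lam i + 1) *
          hVal y (nextPart lam i + ((rho n i : ℤ) - rho n j) - 1) := by
    simp only [Matrix.mul_apply, K, Matrix.of_apply, ite_mul, zero_mul]
    by_cases hi : (i : ℕ) + 1 < n
    · rw [Finset.sum_eq_single_of_mem ⟨i + 1, hi⟩ (Finset.mem_univ _)
        fun l _ hl => if_neg fun h => hl (Fin.ext h), if_pos rfl, nextPart, dif_pos hi]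
      congr 2
      simp only [rho, Fin.val_rev]
      omega
    · rw [Finset.sum_eq_zero fun l _ => if_neg (by omega), nextPart, dif_neg hi, hVal_of_neg,
        mul_zero]
      simp only [rho, Fin.val_rev]
      omega
  rw [jacobiTrudi, ← one_mul (Matrix.det _), ← det_one_sub_K, ← Matrix.det_mul]
  congr 1
  ext i j
  simp only [Pi.add_apply]
  rw [sub_mul, one_mul, Matrix.sub_apply, row_succ]
  simp only [Matrix.of_apply, Nat.cast_add, add_sub_assoc (_ : ℤ) (rho n i : ℤ)]
  rw [hVal_add_eq_sum_Icc y _ (nextPart_le hl i), add_sub_cancel_left]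

theorem jacobiTrudi_succ (hl : Antitone lam) (y : Fin (m + 1) → R) :
    jacobiTrudi (hVal y) (lam + rho n) =
      ∑ mu ∈ interlacing lam, (∏ i, y (Fin.last m) ^ (lam i - mu i)) *
        jacobiTrudi (hVal fun i => y (Fin.castSucc i)) (mu + rho n) := by
  have rows : (Matrix.of fun i j => ∑ b ∈ Finset.Icc (nextPart lam i) (lam i),
      y (Fin.last m) ^ (lam i - b) *
        hVal (fun l => y (Fin.castSucc l)) (((b + rho n i : ℕ) : ℤ) - rho n j)) =
      fun i => ∑ b ∈ Finset.Icc (nextPart lam i) (lam i), fun j => y (Fin.last m) ^ (lam i - b) *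
        hVal (fun l => y (Fin.castSucc l)) (((b + rho n i : ℕ) : ℤ) - rho n j) := by
    ext i j
    simp
  rw [jacobiTrudi_eq_det_sum hl, rows]
  refine (Matrix.detRowAlternating.toMultilinearMap.map_sum_finset _ _).trans
    (Finset.sum_congr rfl fun mu _ => ?_)
  exact Matrix.det_mul_column _ _

theorem hVal_of_isEmpty {ι : Type*} [Fintype ι] [IsEmpty ι] (y : ι → R) {r : ℤ} (hr : r ≠ 0) :
    hVal y r = 0 := by
  rcases lt_or_gt_of_ne hr with h | h
  · exact hVal_of_neg y h
  · lift r to ℕ using h.le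
    rw [hVal_natCast, hSeries, Finset.univ_eq_empty, Finset.prod_empty, PowerSeries.coeff_one,
      if_neg (by exact_mod_cast hr)]

theorem jacobiTrudi_hVal_rho {ι : Type*} [Fintype ι] (y : ι → R) :
    jacobiTrudi (hVal y) (rho n) = 1 := by
  rw [jacobiTrudi_eq_prod fun i j hij => hVal_of_neg y ?_]
  · exact Finset.prod_eq_one fun i _ => by rw [sub_self, hVal_zero]
  · simp only [rho, Fin.val_rev]
    omega

/-- Both sides obey the same branching rule when the last variable is removed. -/
theorem jacobiTrudi_eq_tableauSum (hl : Antitone lam) (y : Fin m → R) :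
    jacobiTrudi (hVal y) (lam + rho n) = tableauSum lam y := by
  induction m generalizing lam with
  | succ m ih =>
    rw [jacobiTrudi_succ hl, tableauSum_succ hl]
    exact Finset.sum_congr rfl fun mu hmu => by rw [ih (antitone_of_mem_interlacing hl hmu)]
  | zero =>
    rcases eq_or_ne lam 0 with rfl | hlam
    · rw [zero_add, jacobiTrudi_hVal_rho, tableauSum_zero]
    · rw [tableauSum_of_isEmpty hlam]
      obtain ⟨i, hi⟩ := Function.ne_iff.1 hlam
      have first_pos : 0 < lam ⟨0, i.pos⟩ :=
        (Nat.pos_of_ne_zero hi).trans_le (hl (Fin.mk_le_of_le_val (Nat.zero_le _)))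
      refine Matrix.det_eq_zero_of_row_eq_zero ⟨0, i.pos⟩ fun j => hVal_of_isEmpty y ?_
      simp only [Pi.add_apply, rho, Fin.val_rev]
      omega

end JacobiTrudi

/-! ### Alternants and the bialternant formula -/

section Alternant

variable {R : Type*} [CommRing R] {n : ℕ}

/-- The alternant `a_a(y) = det (y_l ^ a_i)`. -/
def alternant (y : Fin n → R) (a : Fin n → ℕ) : R := Matrix.det (Matrix.of fun i l => y l ^ a i)

theorem alternant_eq_sum (y : Fin n → R) (a : Fin n → ℕ) :
    alternant y a = ∑ w : Equiv.Perm (Fin n), (Equiv.Perm.sign w : ℤ) * ∏ l, y l ^ a (w l) :=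
  Matrix.det_apply' _

theorem alternant_of_not_injective (y : Fin n → R) {a : Fin n → ℕ} (ha : ¬ Function.Injective a) :
    alternant y a = 0 := by
  obtain ⟨i, j, hij, hne⟩ := Function.not_injective_iff.1 ha
  exact Matrix.det_zero_of_row_eq hne (funext fun l => by simp only [Matrix.of_apply, hij])

theorem alternant_add_one (y : Fin n → R) (a : Fin n → ℕ) :
    alternant y (a + 1) = (∏ l, y l) * alternant y a := by
  rw [alternant, alternant, ← Matrix.det_mul_row]
  congr 1
  ext i l
  simp [pow_succ']

theorem alternant_update_add {y : Fin n → R} {N : ℕ} {c : R} (hy : ∀ l, y l ^ N = c)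
    (a : Fin n → ℕ) (i : Fin n) (b : ℕ) :
    alternant y (Function.update a i (b + N)) = c * alternant y (Function.update a i b) := by
  have row_update (b : ℕ) : Matrix.of (fun j l => y l ^ Function.update a i b j) =
      Matrix.updateRow (Matrix.of fun j l => y l ^ a j) i fun l => y l ^ b := by
    ext j l
    rcases eq_or_ne j i with rfl | hj
    · simp
    · simp [hj]
  rw [alternant, alternant, row_update, row_update, ← Matrix.det_updateRow_smul]
  congr 2
  ext l
  rw [pow_add, hy, mul_comm, Pi.smul_apply, smul_eq_mul]

theorem alternant_rho_ne_zero [IsDomain R] {y : Fin n → R} (hy : Function.Injective y) :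
    alternant y (rho n) ≠ 0 := by
  have reverse_rows : alternant y (rho n) =
      ((Matrix.vandermonde y).transpose.submatrix Fin.revPerm id).det := by
    rw [alternant]
    congr 1
  rw [reverse_rows, Matrix.det_permute, Matrix.det_transpose]
  refine mul_ne_zero ?_ (Matrix.det_vandermonde_ne_zero_iff.2 hy)
  exact_mod_cast ((Equiv.Perm.sign (Fin.revPerm (n := n))).isUnit.map (Int.castRingHom R)).ne_zero

theorem aeval_mul_alternant {A : Type*} [CommRing A] [Algebra A R] {f : MvPolynomial (Fin n) A}
    (hf : f.IsSymmetric) (y : Fin n → R) (a : Fin n → ℕ) :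
    MvPolynomial.aeval y f * alternant y a =
      ∑ b ∈ f.support, f.coeff b • alternant y (a + b) := by
  have aeval_eq (w : Equiv.Perm (Fin n)) :
      MvPolynomial.aeval y f = ∑ b ∈ f.support, f.coeff b • ∏ l, y l ^ b (w l) := by
    conv_lhs => rw [← hf w.symm]
    rw [MvPolynomial.aeval_rename, MvPolynomial.aeval_def, MvPolynomial.eval₂_eq']
    refine Finset.sum_congr rfl fun b _ => ?_
    rw [← Equiv.prod_comp w.symm (fun l => y l ^ b (w l)), Algebra.smul_def]
    simp only [Function.comp_apply, Equiv.apply_symm_apply]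
  simp only [alternant_eq_sum, Finset.mul_sum, Finset.smul_sum]
  rw [Finset.sum_comm]
  refine Finset.sum_congr rfl fun w _ => ?_
  rw [aeval_eq w, Finset.sum_mul]
  refine Finset.sum_congr rfl fun b _ => ?_
  simp only [Pi.add_apply, pow_add, Finset.prod_mul_distrib, Algebra.smul_def]
  ring

/-- The coefficients of the products `∏ m ≠ l, (1 - y_m X)`, in reversed order. -/
def cofactorMatrix (y : Fin n → R) : Matrix (Fin n) (Fin n) R :=
  Matrix.of fun j l => PowerSeries.coeff (rho n j) (eSeries (Finset.univ.erase l) y)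

theorem sum_hVal_mul_cofactorMatrix (y : Fin n → R) (a : ℕ) (l : Fin n) :
    ∑ j, hVal y ((a : ℤ) - rho n j) * cofactorMatrix y j l = y l ^ a := by
  have coeff_eq_zero (i : ℕ) (hi : n ≤ i) :
      PowerSeries.coeff i (eSeries (Finset.univ.erase l) y) = 0 := by
    refine coeff_eSeries_eq_zero _ _ ?_
    rw [Finset.card_erase_of_mem (Finset.mem_univ l), Finset.card_univ, Fintype.card_fin]
    have := l.pos
    omega
  have expansion := sum_coeff_mul_hVal y coeff_eq_zero a
  rw [eSeries_erase_mul_hSeries, PowerSeries.coeff_mk, ← Fin.sum_univ_eq_sum_range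
    (fun i => PowerSeries.coeff i (eSeries (Finset.univ.erase l) y) * hVal y ((a : ℤ) - i))]
    at expansion
  rw [← expansion, ← Equiv.sum_comp Fin.revPerm]
  exact Finset.sum_congr rfl fun j _ => by
    rw [cofactorMatrix, Matrix.of_apply, Fin.revPerm_apply, rho, Fin.rev_rev, mul_comm]

theorem jacobiTrudi_mul_det_cofactorMatrix (y : Fin n → R) (a : Fin n → ℕ) :
    jacobiTrudi (hVal y) a * (cofactorMatrix y).det = alternant y a := by
  rw [jacobiTrudi, ← Matrix.det_mul, alternant]
  congr 1
  ext i l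
  exact sum_hVal_mul_cofactorMatrix y (a i) l

theorem det_cofactorMatrix (y : Fin n → R) : (cofactorMatrix y).det = alternant y (rho n) := by
  rw [← jacobiTrudi_mul_det_cofactorMatrix, jacobiTrudi_hVal_rho, one_mul]

theorem jacobiTrudi_mul_alternant_rho (y : Fin n → R) (a : Fin n → ℕ) :
    jacobiTrudi (hVal y) a * alternant y (rho n) = alternant y a := by
  rw [← det_cofactorMatrix, jacobiTrudi_mul_det_cofactorMatrix]

theorem hVal_eq_zero_of_pow_eq [IsDomain R] {y : Fin n → R} (hy : Function.Injective y) {N : ℕ}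
    {c : R} (hpow : ∀ l, y l ^ N = c) {r : ℕ} (hN : N < r + n) (hr : r < N) : hVal y r = 0 := by
  have : NeZero n := ⟨by omega⟩
  let j : Fin n := ⟨N - r, by omega⟩
  have hj : j ≠ 0 := Fin.ne_of_val_ne (by simp only [j, Fin.val_zero]; omega)
  have exponent_eq : r + rho n 0 = rho n j + N := by
    simp only [rho, Fin.val_rev, j, Fin.val_zero]
    omega
  have hVal_eq : hVal y r = jacobiTrudi (hVal y) (Function.update (rho n) 0 (r + rho n 0)) := by
    rw [jacobiTrudi_update_rho (fun _ => hVal_of_neg y) (hVal_zero y)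
      fun l hl => absurd hl (Fin.not_lt_zero l), Nat.cast_add, add_sub_cancel_right]
  have not_injective : ¬ Function.Injective (Function.update (rho n) 0 (rho n j)) :=
    Function.not_injective_iff.2
      ⟨0, j, by rw [Function.update_self, Function.update_of_ne hj], hj.symm⟩
  refine (mul_eq_zero.1 ?_).resolve_right (alternant_rho_ne_zero hy)
  rw [hVal_eq, jacobiTrudi_mul_alternant_rho, exponent_eq, alternant_update_add hpow,
    alternant_of_not_injective y not_injective, mul_zero]

end Alternant

/-! ### Symmetric polynomials as polynomials in `e_1, …, e_n` -/

section ERing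

variable {n : ℕ}

/-- The symmetric polynomial in `y_1, …, y_n` given by an element of `ℂ[e_1, …, e_n]`. -/
def symHom (n : ℕ) : ERing n →ₐ[ℂ] MvPolynomial (Fin n) ℂ :=
  (MvPolynomial.symmetricSubalgebra (Fin n) ℂ).val.comp (toSym n).toAlgHom

theorem symHom_apply (q : ERing n) : symHom n q = (toSym n q).1 := rfl

theorem symHom_injective : Function.Injective (symHom n) :=
  Subtype.val_injective.comp (toSym n).injective

theorem symHom_isSymmetric (q : ERing n) : (symHom n q).IsSymmetric := (toSym n q).2

theorem exists_symHom_eq {f : MvPolynomial (Fin n) ℂ} (hf : f.IsSymmetric) :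
    ∃ q, symHom n q = f := ⟨(toSym n).symm ⟨f, hf⟩, by rw [symHom_apply, AlgEquiv.apply_symm_apply]⟩

theorem symHom_e (r : ℕ) : symHom n (e n r) = MvPolynomial.esymm (Fin n) ℂ r := by
  rw [symHom_apply, e, AlgEquiv.apply_symm_apply]

theorem symHom_h (r : ℕ) : symHom n (h n r) = MvPolynomial.hsymm (Fin n) ℂ r := by
  rw [symHom_apply, h, AlgEquiv.apply_symm_apply]

theorem symHom_p (r : ℕ) : symHom n (p n r) = MvPolynomial.psum (Fin n) ℂ r := by
  rw [symHom_apply, p, AlgEquiv.apply_symm_apply]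

theorem symHom_X (i : Fin n) :
    symHom n (MvPolynomial.X i) = MvPolynomial.esymm (Fin n) ℂ (i + 1) := by
  change (MvPolynomial.esymmAlgHom (Fin n) ℂ n (MvPolynomial.X i)).1 = _
  rw [MvPolynomial.esymmAlgHom_apply, MvPolynomial.aeval_X]

/-- The complete symmetric polynomial of degree `r` in `ℂ[e_1, …, e_n]`, which is `0` for
negative `r`. -/
def hInt (n : ℕ) (r : ℤ) : ERing n := if r < 0 then 0 else h n r.toNat

theorem hInt_of_neg {r : ℤ} (hr : r < 0) : hInt n r = 0 := if_pos hr

theorem hInt_natCast (r : ℕ) : hInt n r = h n r := by simp [hInt]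

theorem symHom_hInt (r : ℤ) : symHom n (hInt n r) = hVal MvPolynomial.X r := by
  rcases lt_or_ge r 0 with hr | hr
  · rw [hInt_of_neg hr, map_zero, hVal_of_neg _ hr]
  · lift r to ℕ using hr
    rw [hInt_natCast, symHom_h, ← aeval_hsymm (A := ℂ), MvPolynomial.aeval_X_left_apply]

theorem hInt_zero : hInt n 0 = 1 := symHom_injective <| by rw [symHom_hInt, hVal_zero, map_one]

/-- For `a = lam + rho`, the Schur polynomial of `lam` in `ℂ[e_1, …, e_n]`. -/
def schurE (a : Fin n → ℕ) : ERing n := jacobiTrudi (hInt n) a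

theorem symHom_schurE (a : Fin n → ℕ) :
    symHom n (schurE a) = jacobiTrudi (hVal MvPolynomial.X) a := by
  rw [schurE, ← AlgHom.coe_toRingHom, map_jacobiTrudi]
  simp only [AlgHom.coe_toRingHom, symHom_hInt]

theorem isSchur_iff {lam : Fin n → ℕ} (hl : Antitone lam) (q : ERing n) :
    IsSchur lam q ↔ q = schurE (lam + rho n) := by
  rw [← symHom_injective.eq_iff, symHom_schurE, jacobiTrudi_eq_tableauSum hl,
    ← schur_eq_tableauSum]
  rfl

theorem schurE_rho : schurE (rho n) = 1 := symHom_injective <| by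
  rw [symHom_schurE, jacobiTrudi_hVal_rho, map_one]

theorem exists_intCast_eq_coeff_schurE (a : Fin n → ℕ) (b : Fin n →₀ ℕ) :
    ∃ z : ℤ, (symHom n (schurE a)).coeff b = z := by
  refine ⟨(jacobiTrudi (hVal (MvPolynomial.X (R := ℤ))) a).coeff b, ?_⟩
  rw [← eq_intCast (Int.castRingHom ℂ), ← MvPolynomial.coeff_map, map_jacobiTrudi, symHom_schurE]
  simp only [map_hVal, MvPolynomial.map_X]

theorem symHom_mul_alternant_injective :
    Function.Injective fun q : ERing n => symHom n q * alternant MvPolynomial.X (rho n) :=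
  (mul_left_injective₀ (alternant_rho_ne_zero (MvPolynomial.X_injective))).comp symHom_injective

theorem symHom_schurE_mul_alternant (a : Fin n → ℕ) :
    symHom n (schurE a) * alternant MvPolynomial.X (rho n) = alternant MvPolynomial.X a := by
  rw [symHom_schurE, jacobiTrudi_mul_alternant_rho]

theorem esymm_self {R : Type*} [CommSemiring R] :
    MvPolynomial.esymm (Fin n) R n = ∏ i, MvPolynomial.X i := by
  rw [MvPolynomial.esymm]
  conv_lhs => enter [1, 1]; rw [← Finset.card_fin n]
  rw [Finset.powersetCard_self, Finset.sum_singleton]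

theorem schurE_add_one (a : Fin n → ℕ) : schurE (a + 1) = e n n * schurE a := by
  refine symHom_mul_alternant_injective ?_
  simp only [map_mul, mul_assoc, symHom_schurE_mul_alternant, symHom_e, esymm_self,
    alternant_add_one]

theorem mul_schurE (q : ERing n) (a : Fin n → ℕ) :
    q * schurE a = ∑ b ∈ (symHom n q).support, (symHom n q).coeff b • schurE (a + ⇑b) := by
  refine symHom_mul_alternant_injective ?_
  simp only [map_mul, mul_assoc, map_sum, map_smul, Finset.sum_mul, smul_mul_assoc,
    symHom_schurE_mul_alternant]
  rw [← aeval_mul_alternant (symHom_isSymmetric q), MvPolynomial.aeval_X_left_apply]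

/-- Evaluation of an element of `ℂ[e_1, …, e_n]` at the values `y` of the variables
`y_1, …, y_n`. -/
def evalAt (y : Fin n → ℂ) : ERing n →ₐ[ℂ] ℂ := (MvPolynomial.aeval y).comp (symHom n)

theorem evalAt_apply (y : Fin n → ℂ) (q : ERing n) :
    evalAt y q = MvPolynomial.aeval y (symHom n q) := rfl

theorem evalAt_h (y : Fin n → ℂ) (r : ℕ) : evalAt y (h n r) = hVal y r := by
  rw [evalAt_apply, symHom_h, aeval_hsymm]

theorem evalAt_e_self (y : Fin n → ℂ) : evalAt y (e n n) = ∏ i, y i := by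
  rw [evalAt_apply, symHom_e, esymm_self, map_prod]
  simp only [MvPolynomial.aeval_X]

theorem evalAt_schurE_mul_alternant (y : Fin n → ℂ) (a : Fin n → ℕ) :
    evalAt y (schurE a) * alternant y (rho n) = alternant y a := by
  rw [evalAt_apply, symHom_schurE, ← AlgHom.coe_toRingHom, map_jacobiTrudi]
  simp only [map_hVal, AlgHom.coe_toRingHom, MvPolynomial.aeval_X]
  exact jacobiTrudi_mul_alternant_rho y a

end ERing

/-! ### The ideal of the fusion potential -/

section Potential

theorem pderiv_esymm {σ A : Type*} [Fintype σ] [DecidableEq σ] [CommRing A] (l : σ) (r : ℕ) :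
    MvPolynomial.pderiv l (MvPolynomial.esymm σ A (r + 1)) =
      ∑ t ∈ (Finset.univ.erase l).powersetCard r, ∏ i ∈ t, MvPolynomial.X i := by
  have pderiv_sum_eq_zero (r : ℕ) : MvPolynomial.pderiv l
      (∑ t ∈ (Finset.univ.erase l).powersetCard r, ∏ i ∈ t,
        (MvPolynomial.X i : MvPolynomial σ A)) = 0 := by
    refine MvPolynomial.pderiv_eq_zero_of_notMem_vars fun hl => ?_
    have mem_supported : ∑ t ∈ (Finset.univ.erase l).powersetCard r,
        ∏ i ∈ t, (MvPolynomial.X i : MvPolynomial σ A) ∈ MvPolynomial.supported A {l}ᶜ :=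
      sum_mem fun t ht => prod_mem fun i hi => Algebra.subset_adjoin <| Set.mem_image_of_mem _
        (Finset.ne_of_mem_erase ((Finset.mem_powersetCard.1 ht).1 hi))
    exact MvPolynomial.mem_supported.1 mem_supported hl rfl
  have esymm_succ : MvPolynomial.esymm σ A (r + 1) =
      ∑ t ∈ (Finset.univ.erase l).powersetCard (r + 1), ∏ i ∈ t, MvPolynomial.X i +
        MvPolynomial.X l *
          ∑ t ∈ (Finset.univ.erase l).powersetCard r, ∏ i ∈ t, MvPolynomial.X i := by
    have powersetCard_succ := Finset.powersetCard_succ_insert (Finset.notMem_erase l Finset.univ) r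
    rw [Finset.insert_erase (Finset.mem_univ l)] at powersetCard_succ
    have notMem {r : ℕ} {t : Finset σ} (ht : t ∈ (Finset.univ.erase l).powersetCard r) : l ∉ t :=
      fun hl => Finset.notMem_erase l Finset.univ ((Finset.mem_powersetCard.1 ht).1 hl)
    rw [MvPolynomial.esymm, powersetCard_succ, Finset.sum_union, Finset.sum_image, Finset.mul_sum]
    · exact congrArg _ (Finset.sum_congr rfl fun t ht => Finset.prod_insert (notMem ht))
    · exact fun s hs t ht hst => by
        rw [← Finset.erase_insert (notMem hs), hst, Finset.erase_insert (notMem ht)]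
    · refine Finset.disjoint_left.2 fun t ht ht' => notMem ht ?_
      obtain ⟨s, -, rfl⟩ := Finset.mem_image.1 ht'
      exact Finset.mem_insert_self l s
  rw [esymm_succ, map_add, MvPolynomial.pderiv_mul, pderiv_sum_eq_zero, pderiv_sum_eq_zero,
    MvPolynomial.pderiv_X_self, one_mul, mul_zero, add_zero, zero_add]

theorem pderiv_psum {σ A : Type*} [Fintype σ] [CommRing A] (l : σ) (r : ℕ) :
    MvPolynomial.pderiv l (MvPolynomial.psum σ A (r + 1)) =
      ((r : MvPolynomial σ A) + 1) * MvPolynomial.X l ^ r := by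
  rw [MvPolynomial.psum, map_sum, Fintype.sum_eq_single l fun j hj => by
    rw [MvPolynomial.pderiv_pow, MvPolynomial.pderiv_X_of_ne hj, mul_zero],
    MvPolynomial.pderiv_pow, MvPolynomial.pderiv_X_self, mul_one, Nat.add_sub_cancel, Nat.cast_succ]

theorem derivation_aeval {σ A B : Type*} [Fintype σ] [CommRing A] [CommRing B] [Algebra A B]
    (D : Derivation A B B) (f : σ → B) (q : MvPolynomial σ A) :
    D (MvPolynomial.aeval f q) =
      ∑ i, MvPolynomial.aeval f (MvPolynomial.pderiv i q) * D (f i) := by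
  classical
  induction q using MvPolynomial.induction_on with
  | C a => simp
  | add q r hq hr => simp only [map_add, hq, hr, add_mul, Finset.sum_add_distrib]
  | mul_X q j hq =>
    simp only [map_mul, MvPolynomial.aeval_X, Derivation.leibniz, smul_eq_mul, hq, map_add, add_mul,
      Finset.sum_add_distrib, Finset.mul_sum, MvPolynomial.pderiv_X, Pi.single_apply, apply_ite,
      map_zero, mul_one, mul_zero, ite_mul, zero_mul, Finset.sum_ite_eq,
      Finset.mem_univ, if_true, mul_assoc]

variable {n : ℕ}

theorem symHom_eq_aeval (q : ERing n) :
    symHom n q = MvPolynomial.aeval (fun i : Fin n => MvPolynomial.esymm (Fin n) ℂ (i + 1)) q :=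
  DFunLike.congr_fun (MvPolynomial.algHom_ext fun i => by rw [symHom_X, MvPolynomial.aeval_X]) q

theorem sum_symHom_pderiv_mul_coeff (q : ERing n) (l : Fin n) :
    ∑ i : Fin n, symHom n (MvPolynomial.pderiv i q) * ((-1) ^ (i : ℕ) *
      PowerSeries.coeff i (eSeries (Finset.univ.erase l) MvPolynomial.X)) =
        MvPolynomial.pderiv l (symHom n q) := by
  rw [symHom_eq_aeval, derivation_aeval]
  refine Finset.sum_congr rfl fun i _ => ?_
  rw [symHom_eq_aeval, pderiv_esymm, coeff_eSeries, ← mul_assoc (_ ^ _), ← mul_pow, neg_mul_neg,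
    one_mul, one_pow, one_mul]

theorem pderiv_p (i : Fin n) (N : ℕ) :
    MvPolynomial.pderiv i (p n (N + 1)) = (-1) ^ (i : ℕ) * ((N + 1) * hInt n ((N : ℤ) - i)) := by
  have det_ne_zero :
      (cofactorMatrix (MvPolynomial.X : Fin n → MvPolynomial (Fin n) ℂ)).det ≠ 0 := by
    rw [det_cofactorMatrix]
    exact alternant_rho_ne_zero MvPolynomial.X_injective
  let v (j : Fin n) : MvPolynomial (Fin n) ℂ :=
    (-1) ^ rho n j * symHom n (MvPolynomial.pderiv j.rev (p n (N + 1))) -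
      ((N : MvPolynomial (Fin n) ℂ) + 1) * hVal MvPolynomial.X ((N : ℤ) - rho n j)
  have vecMul_eq_zero : Matrix.vecMul v (cofactorMatrix MvPolynomial.X) = 0 := by
    ext1 l
    have power_sum := sum_symHom_pderiv_mul_coeff (p n (N + 1)) l
    rw [symHom_p, pderiv_psum, ← sum_hVal_mul_cofactorMatrix, Finset.mul_sum,
      ← Equiv.sum_comp Fin.revPerm, ← sub_eq_zero, ← Finset.sum_sub_distrib] at power_sum
    rw [Pi.zero_apply, ← power_sum, Matrix.vecMul, dotProduct]
    refine Finset.sum_congr rfl fun j _ => ?_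
    simp only [v, cofactorMatrix, Matrix.of_apply, Fin.revPerm_apply, rho]
    ring
  have v_eq_zero := congrFun (Matrix.eq_zero_of_vecMul_eq_zero det_ne_zero vecMul_eq_zero) i.rev
  simp only [v, rho, Fin.rev_rev, Pi.zero_apply, sub_eq_zero] at v_eq_zero
  refine symHom_injective ?_
  simp only [map_mul, map_pow, map_neg, map_one, map_add, map_natCast, symHom_hInt]
  rw [← v_eq_zero, ← mul_assoc, ← mul_pow, neg_mul_neg, one_mul, one_pow, one_mul]

theorem pderiv_gepnerPotential {k r : ℕ} {i : Fin n} (hr : r + i + 1 = n + k) :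
    MvPolynomial.pderiv i (gepnerPotential n k) = (-1) ^ (i : ℕ) * h n r := by
  have cast_eq : (n : ℂ) + k = ((r + i : ℕ) : ℂ) + 1 := by exact_mod_cast hr.symm
  have C_mul : MvPolynomial.C (1 / ((n : ℂ) + k)) * (((r + i : ℕ) : ERing n) + 1) = 1 := by
    have cast_ne_zero : ((r + i : ℕ) : ℂ) + 1 ≠ 0 := Nat.cast_add_one_ne_zero _
    rw [cast_eq, ← map_natCast (MvPolynomial.C (R := ℂ)), ← map_one MvPolynomial.C, ← map_add,
      ← map_mul, one_div_mul_cancel cast_ne_zero]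
  rw [gepnerPotential, MvPolynomial.pderiv_C_mul, ← hr, pderiv_p, mul_left_comm,
    ← mul_assoc _ _ (hInt _ _), C_mul, one_mul, Nat.cast_add, add_sub_cancel_right, hInt_natCast]

theorem potentialIdeal_eq_gepnerIdeal (n k : ℕ) : potentialIdeal n k = gepnerIdeal n k := by
  refine le_antisymm
    (Ideal.span_le.2 (Set.insert_subset (Ideal.subset_span (Set.mem_insert _ _)) ?_))
    (Ideal.span_le.2 (Set.insert_subset (Ideal.subset_span (Set.mem_insert _ _)) ?_))
  · rintro q ⟨i, hi, rfl⟩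
    rw [pderiv_gepnerPotential (r := n + k - 1 - i) (by omega)]
    exact Ideal.mul_mem_left _ _
      (Ideal.subset_span (Set.mem_insert_of_mem _ ⟨_, by omega, by omega, rfl⟩))
  · rintro q ⟨r, hr, hr', rfl⟩
    let i : Fin n := ⟨n + k - 1 - r, by omega⟩
    have h_eq : h n r = (-1) ^ (i : ℕ) * MvPolynomial.pderiv i (gepnerPotential n k) := by
      rw [pderiv_gepnerPotential (r := r) (by simp only [i]; omega), ← mul_assoc, ← mul_pow,
        neg_mul_neg, one_mul, one_pow, one_mul]
    rw [h_eq]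
    exact Ideal.mul_mem_left _ _
      (Ideal.subset_span (Set.mem_insert_of_mem _ ⟨i, by simp only [i]; omega, rfl⟩))

end Potential

/-! ### Hooks and the Goodman–Wenzl ideal -/

section Hook

variable {n : ℕ}

/-- The hook `(a, 1, …, 1, 0, …)` with `J` entries `1` after the first part `a`. -/
def hook (n a J : ℕ) (i : Fin n) : ℕ := if (i : ℕ) = 0 then a else if (i : ℕ) ≤ J then 1 else 0

theorem antitone_hook (n a J : ℕ) : Antitone (hook n (a + 1) J) := by
  intro i j hij
  have : (i : ℕ) ≤ j := hij
  unfold hook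
  split_ifs <;> omega

theorem hook_add_rho_comp_cycleRange (a : ℕ) (J : Fin n) :
    (hook n a J + rho n) ∘ Fin.cycleRange J = Function.update (rho n) J (a + (n - 1)) := by
  ext i
  have : NeZero n := ⟨J.pos.ne'⟩
  simp only [Function.comp_apply, Pi.add_apply, hook, rho, Fin.val_rev]
  rcases lt_trichotomy i J with hi | rfl | hi
  · have : (i : ℕ) < J := hi
    rw [Function.update_of_ne hi.ne, Fin.coe_cycleRange_of_lt hi, if_neg (by omega),
      if_pos (by omega), rho, Fin.val_rev]
    omega
  · rw [Function.update_self, Fin.cycleRange_self]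
    simp
  · have : (J : ℕ) < i := hi
    rw [Function.update_of_ne hi.ne', Fin.cycleRange_of_gt hi, if_neg (by omega),
      if_neg (by omega), rho, Fin.val_rev, zero_add]

/-- In the Jacobi–Trudi determinant of a hook, moving the first row into the `J`-th place makes the
matrix upper triangular as soon as the smaller hooks vanish. -/
theorem eq_zero_of_jacobiTrudi_hook_eq_zero {R : Type*} [CommRing R] {H : ℤ → R}
    (hneg : ∀ r < 0, H r = 0) (h0 : H 0 = 1) {a : ℕ} {J : Fin n}
    (hlt : ∀ j < J, H ((a : ℤ) + j) = 0) (hhook : jacobiTrudi H (hook n a J + rho n) = 0) :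
    H ((a : ℤ) + J) = 0 := by
  have sub_rho (j : Fin n) : ((a + (n - 1) : ℕ) : ℤ) - rho n j = a + j := by
    simp only [rho, Fin.val_rev]
    omega
  rw [← sub_rho, ← jacobiTrudi_update_rho hneg h0 fun j hj => by rw [sub_rho, hlt j hj],
    ← hook_add_rho_comp_cycleRange, jacobiTrudi_comp_perm, hhook, mul_zero]

theorem schurE_mem_goodmanWenzlIdeal [NeZero n] {k : ℕ} {lam : Fin n → ℕ} (hl : Antitone lam)
    (hk : lam 0 = lam ⊤ + (k + 1)) : schurE (lam + rho n) ∈ goodmanWenzlIdeal n k :=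
  Ideal.subset_span (Set.mem_insert_of_mem _ ⟨lam, hl, hk, (isSchur_iff hl _).2 rfl⟩)

theorem h_mem_goodmanWenzlIdeal [NeZero n] {k j : ℕ} (hj : j + 1 < n) :
    h n (k + 1 + j) ∈ goodmanWenzlIdeal n k := by
  induction j using Nat.strong_induction_on with
  | _ j ih =>
    let H (r : ℤ) : ERing n ⧸ goodmanWenzlIdeal n k := Ideal.Quotient.mk _ (hInt n r)
    have top_val : ((⊤ : Fin n) : ℕ) = n - 1 := rfl
    have hook_zero : hook n (k + 1) j 0 = hook n (k + 1) j ⊤ + (k + 1) := by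
      simp only [hook, top_val, Fin.val_zero]
      rw [if_pos trivial, if_neg (by omega), if_neg (by omega), zero_add]
    have hook_mem := schurE_mem_goodmanWenzlIdeal (antitone_hook n k j) hook_zero
    have H_natCast (i : ℕ) : H (((k + 1 : ℕ) : ℤ) + i) = Ideal.Quotient.mk _ (h n (k + 1 + i)) := by
      rw [← hInt_natCast, Nat.cast_add (k + 1) i]
    rw [← Ideal.Quotient.eq_zero_iff_mem] at hook_mem ⊢
    rw [← H_natCast]
    refine eq_zero_of_jacobiTrudi_hook_eq_zero (J := (⟨j, by omega⟩ : Fin n))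
      (fun r hr => ?_) ?_ (fun i hi => ?_) ?_
    · simp only [H, hInt_of_neg hr, map_zero]
    · simp only [H, hInt_zero, map_one]
    · rw [H_natCast, Ideal.Quotient.eq_zero_iff_mem]
      exact ih i hi (Nat.lt_of_le_of_lt (Nat.succ_le_succ (Nat.le_of_lt hi)) hj)
    · rw [← hook_mem, schurE, map_jacobiTrudi]

theorem gepnerIdeal_le_goodmanWenzlIdeal (n k : ℕ) [NeZero n] :
    gepnerIdeal n k ≤ goodmanWenzlIdeal n k := by
  refine Ideal.span_le.2 (Set.insert_subset (Ideal.subset_span (Set.mem_insert _ _)) ?_)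
  rintro q ⟨r, hr, hr', rfl⟩
  obtain ⟨j, rfl⟩ := Nat.exists_eq_add_of_le hr
  exact h_mem_goodmanWenzlIdeal (by omega)

end Hook

/-! ### Weights and partitions -/

section Partition

variable {n k : ℕ}

theorem add_sub_le_of_strictAnti {b : Fin n → ℕ} (hb : StrictAnti b) {i j : Fin n} (hij : i ≤ j) :
    b j + (j - i) ≤ b i := by
  have add_le (d : ℕ) : ∀ j : Fin n, (j : ℕ) = i + d → b j + d ≤ b i := by
    induction d with
    | zero => exact fun j hj => (Fin.ext hj ▸ le_rfl : b j ≤ b i)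
    | succ d ih =>
      intro j hj
      have := ih ⟨i + d, by omega⟩ rfl
      have : b j < b ⟨i + d, by omega⟩ := hb (show (i : ℕ) + d < j by omega)
      omega
  exact add_le (j - i) j (Nat.add_sub_cancel' hij).symm

theorem Weight.part_eq_add (m : Weight n k) {i : Fin n} (hi : (i : ℕ) + 1 < n) :
    m.part i = m.1 i + m.part ⟨i + 1, hi⟩ := by
  rw [part, part, ← Fintype.sum_ite_eq i m.1, ← Finset.sum_add_distrib]
  refine Finset.sum_congr rfl fun j _ => ?_
  simp only [Fin.le_def, Fin.ext_iff]
  split_ifs <;> omega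

theorem Weight.part_of_le (m : Weight n k) {i : Fin n} (hi : n ≤ (i : ℕ) + 1) : m.part i = 0 := by
  refine Finset.sum_eq_zero fun j _ => if_neg ?_
  rintro ⟨hij, hj⟩
  have : (i : ℕ) ≤ j := hij
  omega

theorem Weight.part_eq (m : Weight n k) {lam : Fin n → ℕ}
    (hstep : ∀ (i : Fin n) (hi : (i : ℕ) + 1 < n), lam i = m.1 i + lam ⟨i + 1, hi⟩)
    (hlast : ∀ i : Fin n, n ≤ (i : ℕ) + 1 → lam i = 0) : m.part = lam := by
  have part_eq_of_add_eq (d : ℕ) : ∀ i : Fin n, (i : ℕ) + d + 1 = n → m.part i = lam i := by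
    induction d with
    | zero => exact fun i hi => by rw [m.part_of_le hi.ge, hlast i hi.ge]
    | succ d ih =>
      intro i hi
      have hi' : (i : ℕ) + 1 < n := by omega
      rw [m.part_eq_add hi', hstep i hi', ih ⟨i + 1, hi'⟩ (by simp only; omega)]
  exact funext fun i => part_eq_of_add_eq (n - 1 - i) i (by omega)

theorem Weight.antitone_part (m : Weight n k) : Antitone m.part := by
  intro i j hij
  refine Finset.sum_le_sum fun l _ => ?_
  split_ifs with hj hi
  · exact le_rfl
  · exact absurd ⟨hij.trans hj.1, hj.2⟩ hi
  · exact Nat.zero_le _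
  · exact le_rfl

variable [NeZero n]

theorem Weight.part_top (m : Weight n k) : m.part ⊤ = 0 :=
  m.part_of_le (Nat.le_add_of_sub_le le_rfl)

theorem Weight.part_zero_add (m : Weight n k) : m.part 0 + m.1 ⊤ = k := by
  refine Eq.trans ?_ m.2
  rw [part, ← Fintype.sum_ite_eq ⊤ m.1, ← Finset.sum_add_distrib]
  refine Finset.sum_congr rfl fun j _ => ?_
  have top_val : ((⊤ : Fin n) : ℕ) = n - 1 := rfl
  have hj := j.2
  simp only [Fin.zero_le, true_and, Fin.ext_iff, top_val]
  split_ifs <;> omega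

theorem Weight.part_le (m : Weight n k) (i : Fin n) : m.part i ≤ k :=
  (m.antitone_part (Fin.zero_le i)).trans (Nat.le.intro m.part_zero_add)

theorem Weight.part_injective : Function.Injective (Weight.part : Weight n k → Fin n → ℕ) := by
  intro m m' h
  refine Subtype.ext (funext fun i => ?_)
  by_cases hi : (i : ℕ) + 1 < n
  · have label_add := m.part_eq_add hi
    rw [h, m'.part_eq_add hi] at label_add
    exact (Nat.add_right_cancel label_add).symm
  · obtain rfl : i = ⊤ := top_le_iff.1 (Nat.sub_le_of_le_add (not_lt.1 hi))
    have label_add := m.part_zero_add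
    rw [h] at label_add
    exact Nat.add_left_cancel (label_add.trans m'.part_zero_add.symm)

theorem Weight.exists_part_eq {lam : Fin n → ℕ} (hl : Antitone lam) (htop : lam ⊤ = 0)
    (hk : lam 0 ≤ k) : ∃ m : Weight n k, m.part = lam := by
  let label (i : Fin n) : ℕ := if hi : (i : ℕ) + 1 < n then lam i - lam ⟨i + 1, hi⟩ else k - lam 0
  have part_eq_lam {K : ℕ} (hK : ∑ i, label i = K) : Weight.part ⟨label, hK⟩ = lam := by
    refine Weight.part_eq _ (fun i hi => ?_) fun i hi => ?_
    · have := hl (show i ≤ ⟨i + 1, hi⟩ from Nat.le_succ i)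
      simp only [label, dif_pos hi]
      omega
    · obtain rfl : i = ⊤ := top_le_iff.1 (Nat.sub_le_of_le_add hi)
      exact htop
  have label_top : label ⊤ = k - lam 0 := dif_neg (by
    have top_val : ((⊤ : Fin n) : ℕ) = n - 1 := rfl
    omega)
  have sum_label : ∑ i, label i = k := by
    have part_zero_add := Weight.part_zero_add (⟨label, rfl⟩ : Weight n (∑ i, label i))
    rw [part_eq_lam] at part_zero_add
    change lam 0 + label ⊤ = _ at part_zero_add
    omega
  exact ⟨⟨label, sum_label⟩, part_eq_lam _⟩

theorem Weight.part_vac : (Weight.vac n k).part = 0 := by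
  refine Weight.part_eq _ (fun i hi => ?_) fun _ _ => rfl
  have hi' : i ≠ ⊤ := by
    rintro rfl
    exact hi.ne (Nat.sub_add_cancel (NeZero.pos n))
  simp [Weight.vac, Pi.single_eq_of_ne hi']

theorem rho_top : rho n ⊤ = 0 := by
  have top_val : ((⊤ : Fin n) : ℕ) = n - 1 := rfl
  rw [rho, Fin.val_rev, top_val]
  omega

theorem exists_weight_of_strictAnti {b : Fin n → ℕ} (hb : StrictAnti b)
    (hk : b 0 < b ⊤ + (n + k)) : ∃ m : Weight n k, b = m.part + rho n + fun _ => b ⊤ := by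
  have top_val : ((⊤ : Fin n) : ℕ) = n - 1 := rfl
  have rho_add_le (i : Fin n) : rho n i + b ⊤ ≤ b i := by
    have := add_sub_le_of_strictAnti hb (le_top (a := i))
    simp only [rho, Fin.val_rev]
    omega
  obtain ⟨m, hm⟩ := Weight.exists_part_eq (k := k) (lam := fun i => b i - (rho n i + b ⊤))
    (fun i j hij => by
      have := add_sub_le_of_strictAnti hb hij
      have : (i : ℕ) ≤ j := hij
      simp only [rho, Fin.val_rev]
      omega)
    (by simp only [rho_top, zero_add, Nat.sub_self])
    (by simp only [rho, Fin.val_rev, Fin.val_zero]; omega)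
  refine ⟨m, funext fun i => ?_⟩
  rw [hm, Pi.add_apply, Pi.add_apply, add_assoc, Nat.sub_add_cancel (rho_add_le i)]

end Partition

/-! ### Straightening modulo the affine Weyl group -/

section Straightening

variable {R : Type*} [CommRing R] {n k : ℕ} {H : ℤ → R} {c : R}

theorem jacobiTrudi_update_add (hper : ∀ r : ℤ, -n < r → H (r + (n + k)) = c * H r)
    (a : Fin n → ℕ) (i : Fin n) :
    jacobiTrudi H (Function.update a i (a i + (n + k))) = c * jacobiTrudi H a := by
  refine jacobiTrudi_update fun j => ?_
  rw [← hper _ (by simp only [rho, Fin.val_rev]; omega)]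
  push_cast
  ring_nf

theorem jacobiTrudi_add_const (hinv : ∀ a : Fin n → ℕ, jacobiTrudi H (a + 1) = jacobiTrudi H a)
    (a : Fin n → ℕ) (t : ℕ) : jacobiTrudi H (a + fun _ => t) = jacobiTrudi H a := by
  induction t with
  | zero => rfl
  | succ t ih => exact (hinv (a + fun _ => t)).trans ih

/-- The additive group generated by the Jacobi–Trudi determinants of the partitions of the weights
of level `k`. -/
def weightSpan (n k : ℕ) (H : ℤ → R) : Submodule ℤ R :=
  Submodule.span ℤ (Set.range fun m : Weight n k => jacobiTrudi H (m.part + rho n))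

theorem jacobiTrudi_part_mem_weightSpan (m : Weight n k) :
    jacobiTrudi H (m.part + rho n) ∈ weightSpan n k H := Submodule.subset_span ⟨m, rfl⟩

variable [NeZero n]

/-- The exponents allowed here are those of the closure of the affine Weyl alcove and of its images
under the finite Weyl group. -/
theorem jacobiTrudi_mem_weightSpan_of_lt
    (hinv : ∀ a : Fin n → ℕ, jacobiTrudi H (a + 1) = jacobiTrudi H a)
    {b : Fin n → ℕ} (hb : ∀ i j, b i < b j + (n + k)) : jacobiTrudi H b ∈ weightSpan n k H := by
  by_cases b_inj : Function.Injective b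
  swap
  · rw [jacobiTrudi_of_not_injective H b_inj]
    exact zero_mem _
  let w : Equiv.Perm (Fin n) := Fin.revPerm.trans (Tuple.sort b)
  have strictAnti_comp : StrictAnti (b ∘ w) :=
    ((Tuple.monotone_sort b).comp_antitone Fin.rev_anti).strictAnti_of_injective
      (b_inj.comp w.injective)
  obtain ⟨m, hm⟩ := exists_weight_of_strictAnti strictAnti_comp (hb _ _)
  have comp_mem : jacobiTrudi H (b ∘ w) ∈ weightSpan n k H := by
    rw [hm, jacobiTrudi_add_const hinv]
    exact jacobiTrudi_part_mem_weightSpan m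
  have eq_smul : jacobiTrudi H b = (Equiv.Perm.sign w : ℤ) • jacobiTrudi H (b ∘ w) := by
    rw [jacobiTrudi_comp_perm, ← zsmul_eq_mul, smul_smul, ← Units.val_mul, Int.units_mul_self,
      Units.val_one, one_smul]
  exact eq_smul ▸ Submodule.smul_mem _ _ comp_mem

theorem mul_mem_weightSpan (hper : ∀ r : ℤ, -n < r → H (r + (n + k)) = c * H r)
    (hinv : ∀ a : Fin n → ℕ, jacobiTrudi H (a + 1) = jacobiTrudi H a) {x : R}
    (hx : x ∈ weightSpan n k H) : c * x ∈ weightSpan n k H := by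
  refine (Submodule.map_span_le (LinearMap.mulLeft ℤ c) _ _).2 ?_ ⟨x, hx, rfl⟩
  rintro _ ⟨m, rfl⟩
  rw [LinearMap.mulLeft_apply, ← jacobiTrudi_update_add hper _ ⊤]
  refine jacobiTrudi_mem_weightSpan_of_lt hinv fun i j => ?_
  have exponent_top : (m.part + rho n) ⊤ = 0 := by rw [Pi.add_apply, m.part_top, rho_top]
  have exponent_lt (i : Fin n) : (m.part + rho n) i < n + k := by
    have := m.part_le i
    simp only [Pi.add_apply, rho, Fin.val_rev]
    omega
  have exponent_pos {j : Fin n} (hj : j ≠ ⊤) : 0 < (m.part + rho n) j := by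
    have : (j : ℕ) < n - 1 := lt_top_iff_ne_top.2 hj
    simp only [Pi.add_apply, rho, Fin.val_rev]
    omega
  have := exponent_lt i
  simp only [Function.update_apply]
  split_ifs with hi hj hj
  · omega
  · have := exponent_pos hj
    omega
  · omega
  · omega

theorem jacobiTrudi_mem_weightSpan (hper : ∀ r : ℤ, -n < r → H (r + (n + k)) = c * H r)
    (hinv : ∀ a : Fin n → ℕ, jacobiTrudi H (a + 1) = jacobiTrudi H a) (a : Fin n → ℕ) :
    jacobiTrudi H a ∈ weightSpan n k H := by
  induction hs : ∑ i, a i using Nat.strong_induction_on generalizing a with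
  | _ s ih =>
    by_cases lt_level : ∀ i, a i < n + k
    · exact jacobiTrudi_mem_weightSpan_of_lt hinv fun i j => (lt_level i).trans_le le_add_self
    push Not at lt_level
    obtain ⟨i, hi⟩ := lt_level
    obtain ⟨a', rfl⟩ : ∃ a', a = Function.update a' i (a' i + (n + k)) :=
      ⟨Function.update a i (a i - (n + k)), by
        rw [Function.update_self, Function.update_idem, Nat.sub_add_cancel hi,
          Function.update_eq_self]⟩
    have sum_lt : ∑ j, a' j < s := hs ▸ Fintype.sum_strictMono
      (lt_update_self_iff.2 (Nat.lt_add_of_pos_right (Nat.add_pos_left (NeZero.pos n) k)))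
    rw [jacobiTrudi_update_add hper]
    exact mul_mem_weightSpan hper hinv (ih _ sum_lt a' rfl)

end Straightening

section Recurrence

variable {R : Type*} [CommRing R]

theorem eq_zero_of_recurrence {n : ℕ} {d : ℕ → R} {f : ℤ → R}
    (hrec : ∀ r : ℤ, 0 < r → f r = ∑ i ∈ Finset.range n, d i * f (r - (i + 1)))
    (h0 : ∀ r : ℤ, -n < r → r ≤ 0 → f r = 0) {r : ℤ} (hr : -n < r) : f r = 0 := by
  induction hs : (r + n).toNat using Nat.strong_induction_on generalizing r with
  | _ s ih =>
    rcases le_or_gt r 0 with hr0 | hr0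
    · exact h0 r hr hr0
    · rw [hrec r hr0]
      refine Finset.sum_eq_zero fun i hi => ?_
      have hi := Finset.mem_range.1 hi
      rw [ih (r - (i + 1) + n).toNat (by omega) (by omega) rfl, mul_zero]

theorem hVal_eq_sum_mul {n : ℕ} (y : Fin n → R) {r : ℤ} (hr : 0 < r) :
    hVal y r = ∑ i ∈ Finset.range n, -PowerSeries.coeff (i + 1) (eSeries Finset.univ y) *
      hVal y (r - (i + 1)) := by
  lift r to ℕ using hr.le
  have sum_eq_zero := sum_coeff_mul_hVal y (d := n + 1)
    (fun i hi => coeff_eSeries_eq_zero Finset.univ y (by rwa [Finset.card_fin])) r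
  rw [eSeries_mul_hSeries, PowerSeries.coeff_one, if_neg (by omega), Finset.sum_range_succ',
    coeff_zero_eSeries, one_mul, Nat.cast_zero, sub_zero, add_comm] at sum_eq_zero
  rw [eq_neg_of_add_eq_zero_left sum_eq_zero, ← Finset.sum_neg_distrib]
  push_cast
  simp only [neg_mul]

end Recurrence

section FusionAlgebra

theorem hInt_eq_sum_mul {n : ℕ} {r : ℤ} (hr : 0 < r) :
    hInt n r = ∑ i ∈ Finset.range n, (-1) ^ i * e n (i + 1) * hInt n (r - (i + 1)) := by
  have esymm_eq (i : ℕ) := aeval_esymm (A := ℂ) (MvPolynomial.X : Fin n → MvPolynomial (Fin n) ℂ) i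
  simp only [MvPolynomial.aeval_X_left_apply] at esymm_eq
  refine symHom_injective ?_
  simp only [map_sum, map_mul, map_pow, map_neg, map_one, symHom_hInt, symHom_e]
  rw [hVal_eq_sum_mul _ hr]
  refine Finset.sum_congr rfl fun i _ => ?_
  rw [esymm_eq, ← mul_assoc, ← pow_add, Odd.neg_one_pow ⟨i, by ring⟩, neg_one_mul]

variable (n k : ℕ)

/-- The algebra `ℂ[e_1, …, e_n] / I_{n,k}`. -/
abbrev FusionAlgebra : Type := ERing n ⧸ gepnerIdeal n k

/-- The class of the complete symmetric polynomial `h_r` in the fusion algebra, `0` for negative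
`r`. -/
def hClass (r : ℤ) : FusionAlgebra n k := Ideal.Quotient.mk _ (hInt n r)

variable {n}

/-- For `a = lam + rho`, the class of the Schur polynomial of `lam` in the fusion algebra. -/
def schurClass (a : Fin n → ℕ) : FusionAlgebra n k := Ideal.Quotient.mk _ (schurE a)

theorem schurClass_eq_jacobiTrudi (a : Fin n → ℕ) :
    schurClass k a = jacobiTrudi (hClass n k) a := map_jacobiTrudi _ _ a

theorem schurClass_add_one (a : Fin n → ℕ) : schurClass k (a + 1) = schurClass k a := by
  have mk_e : Ideal.Quotient.mk (gepnerIdeal n k) (e n n) = 1 :=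
    Ideal.Quotient.mk_eq_mk_iff_sub_mem _ _ |>.2 (Ideal.subset_span (Set.mem_insert _ _))
  rw [schurClass, schurE_add_one, map_mul, mk_e, one_mul, schurClass]

variable {k}

theorem hClass_eq_zero {r : ℤ} (hk : k < r) (hr : r < n + k) : hClass n k r = 0 := by
  lift r to ℕ using by omega
  rw [hClass, hInt_natCast]
  exact Ideal.Quotient.eq_zero_iff_mem.2
    (Ideal.subset_span (Set.mem_insert_of_mem _ ⟨r, by omega, by omega, rfl⟩))

theorem hClass_eq_sum_mul {r : ℤ} (hr : 0 < r) :
    hClass n k r = ∑ i ∈ Finset.range n,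
      Ideal.Quotient.mk _ ((-1) ^ i * e n (i + 1)) * hClass n k (r - (i + 1)) := by
  rw [hClass, hInt_eq_sum_mul hr, map_sum]
  simp only [map_mul, hClass]

theorem hClass_add {r : ℤ} (hr : -n < r) :
    hClass n k (r + (n + k)) = hClass n k (n + k) * hClass n k r := by
  refine sub_eq_zero.1 (eq_zero_of_recurrence (n := n) (R := FusionAlgebra n k)
    (f := fun r => hClass n k (r + (n + k)) - hClass n k (n + k) * hClass n k r)
    (d := fun i => Ideal.Quotient.mk _ ((-1) ^ i * e n (i + 1))) (fun r hr => ?_)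
    (fun r hr hr0 => ?_) hr)
  · rw [hClass_eq_sum_mul hr, hClass_eq_sum_mul (r := r + (n + k)) (by omega), Finset.mul_sum,
      ← Finset.sum_sub_distrib]
    refine Finset.sum_congr rfl fun i _ => ?_
    rw [add_sub_right_comm, mul_sub, mul_left_comm]
  · rcases hr0.eq_or_lt with rfl | hr0
    · simp only [hClass, hInt_zero, map_one, mul_one, zero_add, sub_self]
    · have hClass_neg : hClass n k r = 0 := by rw [hClass, hInt_of_neg hr0, map_zero]
      simp only [hClass_neg, hClass_eq_zero (n := n) (k := k) (r := r + (n + k)) (by omega)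
        (by omega), mul_zero, sub_zero]

theorem schurClass_eq_zero {a : Fin n → ℕ} {i j : Fin n} (hij : i ≠ j)
    (ha : a i = a j + (n + k)) : schurClass k a = 0 := by
  have a_eq : Function.update (Function.update a i (a j)) i
      (Function.update a i (a j) i + (n + k)) = a := by
    rw [Function.update_self, Function.update_idem, ← ha, Function.update_eq_self]
  have not_injective : ¬ Function.Injective (Function.update a i (a j)) := fun inj => hij <|
    inj (by rw [Function.update_self, Function.update_of_ne hij.symm])
  rw [schurClass_eq_jacobiTrudi, ← a_eq, jacobiTrudi_update_add fun _ => hClass_add,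
    jacobiTrudi_of_not_injective _ not_injective, mul_zero]

variable [NeZero n]

theorem schurClass_mem_span (a : Fin n → ℕ) :
    schurClass k a ∈ Submodule.span ℤ
      (Set.range fun m : Weight n k => schurClass k (m.part + rho n)) := by
  have mem_weightSpan := jacobiTrudi_mem_weightSpan (fun _ => hClass_add)
    (fun b => by simpa only [schurClass_eq_jacobiTrudi] using schurClass_add_one k b) a
  simpa only [weightSpan, schurClass_eq_jacobiTrudi] using mem_weightSpan

theorem schurClass_mul_mem_span (a b : Fin n → ℕ) :
    schurClass k a * schurClass k b ∈ Submodule.span ℤ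
      (Set.range fun m : Weight n k => schurClass k (m.part + rho n)) := by
  rw [schurClass, schurClass, ← map_mul, mul_schurE, map_sum]
  refine sum_mem fun d _ => ?_
  obtain ⟨z, hz⟩ := exists_intCast_eq_coeff_schurE a d
  rw [hz, Int.cast_smul_eq_zsmul, map_zsmul]
  exact Submodule.smul_mem _ z (schurClass_mem_span _)

theorem span_schurClass :
    Submodule.span ℂ (Set.range fun m : Weight n k => schurClass k (m.part + rho n)) = ⊤ := by
  refine eq_top_iff.2 fun x _ => ?_
  obtain ⟨q, rfl⟩ := Ideal.Quotient.mk_surjective x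
  rw [← mul_one q, ← schurE_rho, mul_schurE, map_sum]
  refine sum_mem fun d _ => ?_
  exact Submodule.smul_mem (Submodule.span ℂ _) _
    (Submodule.span_le_restrictScalars ℤ ℂ _ (schurClass_mem_span (k := k) (rho n + ⇑d)))

theorem goodmanWenzlIdeal_le_gepnerIdeal : goodmanWenzlIdeal n k ≤ gepnerIdeal n k := by
  refine Ideal.span_le.2 (Set.insert_subset (Ideal.subset_span (Set.mem_insert _ _)) ?_)
  rintro _ ⟨lam, hl, hk, hq⟩
  rw [(isSchur_iff hl _).1 hq]
  have zero_ne_top : (0 : Fin n) ≠ ⊤ := by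
    intro zero_eq
    rw [zero_eq] at hk
    omega
  refine Ideal.Quotient.eq_zero_iff_mem.1 (schurClass_eq_zero zero_ne_top ?_)
  rw [Pi.add_apply, Pi.add_apply, hk, rho_top, rho, Fin.val_rev, Fin.val_zero]
  have := NeZero.pos n
  omega

variable (n k) in
theorem goodmanWenzlIdeal_eq_gepnerIdeal : goodmanWenzlIdeal n k = gepnerIdeal n k :=
  goodmanWenzlIdeal_le_gepnerIdeal.antisymm (gepnerIdeal_le_goodmanWenzlIdeal n k)

end FusionAlgebra

/-! ### The points of the fusion variety -/

section Points

/-- `exp (-2πi x / N)`. -/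
def expPoint (N : ℕ) (x : ℝ) : ℂ := Complex.exp (-(2 * Real.pi * Complex.I / N) * x)

theorem expPoint_zero (N : ℕ) : expPoint N 0 = 1 := by
  rw [expPoint, Complex.ofReal_zero, mul_zero, Complex.exp_zero]

theorem expPoint_sum {ι : Type*} (N : ℕ) (s : Finset ι) (x : ι → ℝ) :
    expPoint N (∑ i ∈ s, x i) = ∏ i ∈ s, expPoint N (x i) := by
  rw [expPoint, Complex.ofReal_sum, Finset.mul_sum, Complex.exp_sum]
  rfl

theorem expPoint_pow (N : ℕ) (x : ℝ) (a : ℕ) : expPoint N x ^ a = expPoint N (a * x) := by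
  rw [expPoint, expPoint, ← Complex.exp_nat_mul, Complex.ofReal_mul, Complex.ofReal_natCast,
    mul_left_comm]

theorem expPoint_eq_iff {N : ℕ} [NeZero N] {x y : ℝ} :
    expPoint N x = expPoint N y ↔ ∃ z : ℤ, x - y = N * z := by
  have cast_ne_zero : (N : ℂ) ≠ 0 := NeZero.ne _
  have two_pi_I_ne_zero := Complex.two_pi_I_ne_zero
  have exponent_eq_iff (z : ℤ) : -(2 * Real.pi * Complex.I / N) * x =
      -(2 * Real.pi * Complex.I / N) * y + z * (2 * Real.pi * Complex.I) ↔
        x - y = N * (-z : ℤ) := by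
    rw [← Complex.ofReal_inj, ← mul_right_inj' two_pi_I_ne_zero]
    push_cast
    field_simp
    constructor <;> intro h <;> linear_combination -h
  rw [expPoint, expPoint, Complex.exp_eq_exp_iff_exists_int]
  exact ⟨fun ⟨z, hz⟩ => ⟨-z, (exponent_eq_iff z).1 hz⟩,
    fun ⟨z, hz⟩ => ⟨-z, (exponent_eq_iff (-z)).2 (by rwa [neg_neg])⟩⟩

theorem eq_zero_of_sum_eq_zero_of_sub_le_one {ι : Type*} [Fintype ι] {z : ι → ℤ}
    (hsum : ∑ i, z i = 0) (hle : ∀ i j, z i - z j ≤ 1) : z = 0 := by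
  have nonneg (i : ι) : 0 ≤ z i := by
    by_contra! hi
    obtain ⟨j, -, hj⟩ := Finset.exists_pos_of_sum_zero_of_exists_nonzero z hsum
      ⟨i, Finset.mem_univ i, hi.ne⟩
    have := hle j i
    omega
  exact funext fun i =>
    (Finset.sum_eq_zero_iff_of_nonneg fun i _ => nonneg i).1 hsum i (Finset.mem_univ i)

variable {n k : ℕ}

theorem Weight.shifted_sub_shifted (m : Weight n k) (i j : Fin n) :
    m.shifted i - m.shifted j = ((m.part i + rho n i : ℕ) : ℝ) - (m.part j + rho n j : ℕ) := by
  simp only [shifted, rho, Fin.val_rev]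
  push_cast [Nat.cast_sub (Nat.succ_le_of_lt i.2), Nat.cast_sub (Nat.succ_le_of_lt j.2)]
  ring

theorem Weight.strictAnti_shifted (m : Weight n k) : StrictAnti m.shifted := by
  intro i j hij
  rw [← sub_pos, m.shifted_sub_shifted, sub_pos, Nat.cast_lt]
  exact add_lt_add_of_le_of_lt (m.antitone_part hij.le) (Fin.rev_lt_rev.2 hij)

theorem Weight.sum_shifted (m : Weight n k) : ∑ i, m.shifted i = 0 := by
  rcases n.eq_zero_or_pos with rfl | hn
  · rfl
  have cast_ne_zero : (n : ℝ) ≠ 0 := Nat.cast_ne_zero.2 hn.ne'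
  have sum_val : ∑ i : Fin n, ((i : ℕ) : ℝ) = n * (n - 1) / 2 := by
    rw [Fin.sum_univ_eq_sum_range (fun i => (i : ℝ)) n, ← Nat.cast_sum,
      eq_div_iff two_ne_zero, ← Nat.cast_ofNat, ← Nat.cast_mul, Finset.sum_range_id_mul_two,
      Nat.cast_mul, Nat.cast_pred hn]
  simp only [shifted, Finset.sum_add_distrib, Finset.sum_sub_distrib, sum_val,
    Finset.sum_const, Finset.card_univ, Fintype.card_fin, nsmul_eq_mul]
  field_simp
  ring

/-- The point `exp (-2πi (λ + ρ) / (n + k))` of the fusion variety given by a weight. -/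
def Weight.point (m : Weight n k) (i : Fin n) : ℂ := expPoint (n + k) (m.shifted i)

theorem Weight.prod_point (m : Weight n k) : ∏ i, m.point i = 1 := by
  simp only [point, ← expPoint_sum, m.sum_shifted, expPoint_zero]

theorem exists_eq_of_evalAt_eq {y y' : Fin n → ℂ} (h : evalAt y = evalAt y') (i : Fin n) :
    ∃ j, y' j = y i := by
  obtain ⟨q, hq⟩ := exists_symHom_eq
    (f := ∏ j : Fin n, (MvPolynomial.C (y i) - MvPolynomial.X j)) fun w => by
      simp only [map_prod, map_sub, MvPolynomial.rename_C, MvPolynomial.rename_X]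
      exact Equiv.prod_comp w fun j => MvPolynomial.C (y i) - MvPolynomial.X j
  have evalAt_q (x : Fin n → ℂ) : evalAt x q = ∏ j, (y i - x j) := by
    simp only [evalAt_apply, hq, map_prod, map_sub, MvPolynomial.algHom_C, MvPolynomial.aeval_X,
      Algebra.algebraMap_self_apply]
  have prod_eq_zero : ∏ j, (y i - y' j) = 0 := by
    rw [← evalAt_q, ← h, evalAt_q]
    exact Finset.prod_eq_zero (Finset.mem_univ i) (sub_self _)
  obtain ⟨j, -, hj⟩ := Finset.prod_eq_zero_iff.1 prod_eq_zero
  exact ⟨j, (sub_eq_zero.1 hj).symm⟩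

variable [NeZero n]

instance neZero_level : NeZero (n + k) := ⟨(Nat.add_pos_left (NeZero.pos n) k).ne'⟩

theorem Weight.shifted_sub_lt (m : Weight n k) (i j : Fin n) :
    m.shifted i - m.shifted j < (n + k : ℕ) := by
  have exponent_lt : m.part i + rho n i < n + k := by
    have := m.part_le i
    simp only [rho, Fin.val_rev]
    omega
  rw [m.shifted_sub_shifted]
  exact (sub_le_self _ (Nat.cast_nonneg _)).trans_lt (Nat.cast_lt.2 exponent_lt)

theorem Weight.eq_zero_of_shifted_sub_eq {l m : Weight n k} {w : Equiv.Perm (Fin n)} {z : Fin n → ℤ}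
    (hz : ∀ i, l.shifted i - m.shifted (w i) = (n + k : ℕ) * z i) : z = 0 := by
  have level_pos : 0 < ((n + k : ℕ) : ℝ) := Nat.cast_pos.2 (NeZero.pos _)
  have sum_z : ∑ i, z i = 0 := by
    have sum_eq : ∑ i, (l.shifted i - m.shifted (w i)) = 0 := by
      rw [Finset.sum_sub_distrib, Equiv.sum_comp w m.shifted, l.sum_shifted, m.sum_shifted,
        sub_zero]
    rw [Finset.sum_congr rfl fun i _ => hz i, ← Finset.mul_sum] at sum_eq
    exact_mod_cast (mul_eq_zero.1 sum_eq).resolve_left level_pos.ne'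
  have sub_le_one (i j : Fin n) : z i - z j ≤ 1 := by
    have lt_two : ((n + k : ℕ) : ℝ) * (z i - z j) < (n + k : ℕ) * 2 := by
      have := l.shifted_sub_lt i j
      have := m.shifted_sub_lt (w j) (w i)
      rw [mul_sub, ← hz, ← hz]
      linarith
    have lt_two : z i - z j < 2 := by exact_mod_cast (mul_lt_mul_iff_right₀ level_pos).1 lt_two
    omega
  exact eq_zero_of_sum_eq_zero_of_sub_le_one sum_z sub_le_one

theorem Weight.shifted_injective :
    Function.Injective (Weight.shifted : Weight n k → Fin n → ℝ) := by
  intro l m h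
  refine Weight.part_injective (funext fun i => ?_)
  have sub_eq := (l.shifted_sub_shifted i ⊤).symm.trans
    ((by rw [h]) : l.shifted i - l.shifted ⊤ = m.shifted i - m.shifted ⊤) |>.trans
    (m.shifted_sub_shifted i ⊤)
  simpa [part_top] using sub_eq

theorem Weight.point_injective (m : Weight n k) : Function.Injective m.point := by
  intro i j hij
  obtain ⟨z, hz⟩ := expPoint_eq_iff.1 hij
  have level_pos : 0 < ((n + k : ℕ) : ℝ) := Nat.cast_pos.2 (NeZero.pos _)
  have z_lt : (z : ℝ) < 1 := by
    rw [← mul_lt_iff_lt_one_right level_pos, ← hz]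
    exact m.shifted_sub_lt i j
  have lt_z : ((-z : ℤ) : ℝ) < 1 := by
    rw [← mul_lt_iff_lt_one_right level_pos, Int.cast_neg, mul_neg, ← hz, neg_sub]
    exact m.shifted_sub_lt j i
  norm_cast at z_lt lt_z
  obtain rfl : z = 0 := by omega
  rw [Int.cast_zero, mul_zero, sub_eq_zero] at hz
  exact m.strictAnti_shifted.injective hz

theorem Weight.point_pow (m : Weight n k) (i j : Fin n) :
    m.point i ^ (n + k) = m.point j ^ (n + k) := by
  rw [point, point, expPoint_pow, expPoint_pow, expPoint_eq_iff, ← mul_sub, m.shifted_sub_shifted]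
  exact ⟨(m.part i + rho n i : ℕ) - (m.part j + rho n j : ℕ), by push_cast; rfl⟩

theorem evalAt_point_eq_zero (m : Weight n k) {q : ERing n} (hq : q ∈ gepnerIdeal n k) :
    evalAt m.point q = 0 := by
  suffices gepnerIdeal n k ≤ RingHom.ker (evalAt m.point) from this hq
  refine Ideal.span_le.2 (Set.insert_subset ?_ ?_)
  · rw [SetLike.mem_coe, RingHom.mem_ker, map_sub, map_one, evalAt_e_self, m.prod_point, sub_self]
  · rintro _ ⟨r, hr, hr', rfl⟩
    rw [SetLike.mem_coe, RingHom.mem_ker, evalAt_h]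
    exact hVal_eq_zero_of_pow_eq m.point_injective (fun i => m.point_pow i 0) (by omega) (by omega)

theorem evalAt_point_injective : Function.Injective fun m : Weight n k => evalAt m.point := by
  intro l m hlm
  choose w hw using exists_eq_of_evalAt_eq hlm
  have w_injective : Function.Injective w := fun i j hij =>
    l.point_injective (by rw [← hw, ← hw, hij])
  choose z hz using fun i => expPoint_eq_iff.1 (hw i).symm
  let w' : Equiv.Perm (Fin n) := Equiv.ofBijective w w_injective.bijective_of_finite
  have z_eq_zero : z = 0 := Weight.eq_zero_of_shifted_sub_eq (w := w') hz
  have shifted_eq : l.shifted = m.shifted ∘ w' := funext fun i => by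
    have sub_eq : l.shifted i - m.shifted (w i) = _ := hz i
    rwa [z_eq_zero, Pi.zero_apply, Int.cast_zero, mul_zero, sub_eq_zero] at sub_eq
  refine Weight.shifted_injective
    ((l.strictAnti_shifted.range_inj m.strictAnti_shifted).1 ?_)
  rw [shifted_eq, w'.surjective.range_comp]

end Points

/-! ### The basis of Schur classes -/

section SchurBasis

variable {n k : ℕ} [NeZero n]

/-- Evaluation at the point of a weight, as a character of the fusion algebra. -/
def Weight.character (s : Weight n k) : FusionAlgebra n k →ₐ[ℂ] ℂ :=
  Ideal.Quotient.liftₐ _ (evalAt s.point) fun _ => evalAt_point_eq_zero s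

theorem Weight.character_mk (s : Weight n k) (q : ERing n) :
    s.character (Ideal.Quotient.mk _ q) = evalAt s.point q := rfl

theorem Weight.character_injective :
    Function.Injective (Weight.character : Weight n k → FusionAlgebra n k →ₐ[ℂ] ℂ) :=
  fun s t h => evalAt_point_injective <| AlgHom.ext fun q => by
    rw [← s.character_mk, h, character_mk]

theorem linearIndependent_character :
    LinearIndependent ℂ fun s : Weight n k => s.character.toLinearMap := by
  have dedekind := (linearIndependent_monoidHom (FusionAlgebra n k) ℂ).comp
    (fun s : Weight n k => (s.character : FusionAlgebra n k →* ℂ)) fun s t h =>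
      Weight.character_injective (AlgHom.ext fun x => DFunLike.congr_fun h x)
  exact LinearIndependent.of_comp (LinearMap.ltoFun ℂ (FusionAlgebra n k) ℂ ℂ) dedekind

/-- The values of the Schur polynomials of the weights at the points of the weights. -/
def schurMatrix (n k : ℕ) [NeZero n] : Matrix (Weight n k) (Weight n k) ℂ :=
  Matrix.of fun l s => s.character (schurClass k (l.part + rho n))

theorem schurMatrix_apply (l s : Weight n k) :
    schurMatrix n k l s = s.character (schurClass k (l.part + rho n)) := rfl

theorem isUnit_schurMatrix : IsUnit (schurMatrix n k) := by
  let restrict : Module.Dual ℂ (FusionAlgebra n k) →ₗ[ℂ] Weight n k → ℂ :=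
    LinearMap.pi fun l => LinearMap.applyₗ (schurClass k (l.part + rho n))
  have ker_restrict : LinearMap.ker restrict = ⊥ := LinearMap.ker_eq_bot'.2 fun f hf =>
    LinearMap.ext_on_range span_schurClass fun l => congrFun hf l
  exact Matrix.linearIndependent_cols_iff_isUnit.1
    (linearIndependent_character.map' restrict ker_restrict)

theorem linearIndependent_schurClass :
    LinearIndependent ℂ fun m : Weight n k => schurClass k (m.part + rho n) :=
  LinearIndependent.of_comp (LinearMap.pi fun s : Weight n k => s.character.toLinearMap)
    (Matrix.linearIndependent_rows_iff_isUnit.2 isUnit_schurMatrix)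

/-- The basis of the fusion algebra consisting of the classes of the Schur polynomials of the
weights. -/
def schurBasis (n k : ℕ) [NeZero n] : Module.Basis (Weight n k) ℂ (FusionAlgebra n k) :=
  Module.Basis.mk linearIndependent_schurClass span_schurClass.ge

theorem schurBasis_apply (m : Weight n k) : schurBasis n k m = schurClass k (m.part + rho n) :=
  Module.Basis.mk_apply _ _ m

theorem schurBasis_vac : schurBasis n k (Weight.vac n k) = 1 := by
  rw [schurBasis_apply, Weight.part_vac, zero_add, schurClass, schurE_rho, map_one]

theorem character_schurBasis (l s : Weight n k) :
    s.character (schurBasis n k l) = schurMatrix n k l s := by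
  rw [schurBasis_apply, schurMatrix_apply]

theorem exists_schurBasis_mul_eq (l m : Weight n k) : ∃ c : Weight n k → ℤ,
    schurBasis n k l * schurBasis n k m = ∑ r, c r • schurBasis n k r := by
  simp only [schurBasis_apply]
  obtain ⟨c, hc⟩ := (Submodule.mem_span_range_iff_exists_fun ℤ).1
    (schurClass_mul_mem_span (k := k) (l.part + rho n) (m.part + rho n))
  exact ⟨c, hc.symm⟩

end SchurBasis

/-! ### The Verlinde formula -/

section Verlinde

variable {n k : ℕ}

theorem modS_comm (l s : Weight n k) : modS n k l s = modS n k s l := by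
  rw [modS, modS]
  congr 1
  refine Fintype.sum_equiv (Equiv.inv _) _ _ fun w => ?_
  rw [Equiv.inv_apply, Equiv.Perm.sign_inv,
    ← Equiv.sum_comp w fun i => l.shifted i * s.shifted (w⁻¹ i)]
  simp only [Equiv.Perm.inv_def, Equiv.symm_apply_apply, mul_comm (s.shifted _)]

theorem sum_shifted_mul_shifted (l s : Weight n k) (w : Equiv.Perm (Fin n)) :
    ∑ i, s.shifted i * l.shifted (w i) =
      ∑ i, ((l.part (w i) + rho n (w i) : ℕ) : ℝ) * s.shifted i := by
  rcases isEmpty_or_nonempty (Fin n) with _ | ⟨⟨j⟩⟩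
  · simp only [Finset.univ_eq_empty, Finset.sum_empty]
  · have shifted_eq (i : Fin n) : l.shifted i =
        ((l.part i + rho n i : ℕ) : ℝ) + (l.shifted j - (l.part j + rho n j : ℕ)) := by
      linear_combination l.shifted_sub_shifted i j
    simp only [mul_comm (s.shifted _), shifted_eq (w _), add_mul, Finset.sum_add_distrib,
      ← Finset.mul_sum, s.sum_shifted, mul_zero, add_zero]

theorem sum_sign_mul_exp_eq_alternant (l s : Weight n k) :
    ∑ w : Equiv.Perm (Fin n), ((Equiv.Perm.sign w : ℤ) : ℂ) *
      Complex.exp (-(2 * Real.pi * Complex.I / ((k : ℂ) + n)) *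
        ((∑ i, s.shifted i * l.shifted (w i) : ℝ) : ℂ)) = alternant s.point (l.part + rho n) := by
  rw [alternant_eq_sum, add_comm (k : ℂ), ← Nat.cast_add]
  refine Finset.sum_congr rfl fun w _ => ?_
  rw [sum_shifted_mul_shifted]
  change _ * expPoint (n + k) _ = _
  simp only [expPoint_sum, ← expPoint_pow]
  rfl

variable [NeZero n]

variable (n k) in
theorem exists_modS_eq : ∃ c : ℂ, c ≠ 0 ∧ ∀ l s : Weight n k,
    modS n k l s = c * alternant s.point (l.part + rho n) := by
  refine ⟨_, div_ne_zero (Complex.exp_ne_zero _) ?_, fun l s => by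
    rw [modS, sum_sign_mul_exp_eq_alternant]⟩
  have hn : (0 : ℝ) < n := Nat.cast_pos.2 (NeZero.pos n)
  rw [Complex.ofReal_ne_zero, Real.sqrt_ne_zero']
  positivity

theorem modS_vac_ne_zero (s : Weight n k) : modS n k (Weight.vac n k) s ≠ 0 := by
  obtain ⟨c, hc, modS_eq⟩ := exists_modS_eq n k
  rw [modS_eq, Weight.part_vac, zero_add]
  exact mul_ne_zero hc (alternant_rho_ne_zero s.point_injective)

theorem modS_eq_schurMatrix_mul (l s : Weight n k) :
    modS n k l s = schurMatrix n k l s * modS n k (Weight.vac n k) s := by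
  obtain ⟨c, -, modS_eq⟩ := exists_modS_eq n k
  rw [modS_eq, modS_eq, Weight.part_vac, zero_add, schurMatrix_apply, schurClass,
    Weight.character_mk, mul_left_comm, evalAt_schurE_mul_alternant]

variable (n k) in
theorem isUnit_modS : IsUnit (modS n k) := by
  have modS_eq_mul : modS n k =
      schurMatrix n k * Matrix.diagonal (modS n k (Weight.vac n k)) := by
    ext l s
    rw [Matrix.mul_diagonal, modS_eq_schurMatrix_mul]
  rw [modS_eq_mul]
  exact isUnit_schurMatrix.mul (Matrix.isUnit_diagonal.2 (Pi.isUnit_iff.2 fun s =>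
    (modS_vac_ne_zero s).isUnit))

theorem sum_modS_mul_inv (l r : Weight n k) :
    ∑ s, modS n k l s * (modS n k)⁻¹ r s = if l = r then 1 else 0 := by
  have transpose_modS : (modS n k).transpose = modS n k := Matrix.ext fun l s => modS_comm s l
  have inv_apply (s : Weight n k) : (modS n k)⁻¹ r s = (modS n k)⁻¹ s r := by
    rw [← Matrix.transpose_apply (modS n k)⁻¹ r s, Matrix.transpose_nonsing_inv, transpose_modS]
  simp only [inv_apply]
  rw [← Matrix.mul_apply, Matrix.mul_nonsing_inv _ ((Matrix.isUnit_iff_isUnit_det _).1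
    (isUnit_modS n k)), Matrix.one_apply]

theorem verlinde_eq_of_schurBasis_mul_eq {l m : Weight n k} {c : Weight n k → ℤ}
    (hc : schurBasis n k l * schurBasis n k m = ∑ r, c r • schurBasis n k r) (r : Weight n k) :
    verlinde n k l m r = c r := by
  have schurMatrix_mul (s : Weight n k) :
      schurMatrix n k l s * schurMatrix n k m s = ∑ t, c t * schurMatrix n k t s := by
    simpa only [map_mul, map_sum, map_zsmul, character_schurBasis, zsmul_eq_mul,
      map_intCast]
      using congrArg s.character hc
  have summand_eq (s : Weight n k) :
      modS n k l s * modS n k m s * (modS n k)⁻¹ r s / modS n k (Weight.vac n k) s =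
        ∑ t, c t * (modS n k t s * (modS n k)⁻¹ r s) := by
    have vac_ne_zero := modS_vac_ne_zero s
    calc
      _ = schurMatrix n k l s * schurMatrix n k m s *
          (modS n k (Weight.vac n k) s * (modS n k)⁻¹ r s) := by
        rw [modS_eq_schurMatrix_mul l, modS_eq_schurMatrix_mul m]
        field_simp
      _ = _ := by
        rw [schurMatrix_mul, Finset.sum_mul]
        refine Finset.sum_congr rfl fun t _ => ?_
        rw [modS_eq_schurMatrix_mul t, mul_assoc, mul_assoc]
  simp only [verlinde, summand_eq]
  rw [Finset.sum_comm]
  simp only [← Finset.mul_sum, sum_modS_mul_inv, mul_ite, mul_one, mul_zero, Finset.sum_ite_eq',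
    Finset.mem_univ, if_true]

theorem fusionCoeff_eq_of_schurBasis_mul_eq {l m : Weight n k} {c : Weight n k → ℤ}
    (hc : schurBasis n k l * schurBasis n k m = ∑ r, c r • schurBasis n k r) (r : Weight n k) :
    fusionCoeff n k l m r = c r := by
  rw [fusionCoeff, verlinde_eq_of_schurBasis_mul_eq hc, Complex.intCast_re, round_intCast]

theorem fusionCoeff_eq_verlinde (l m r : Weight n k) :
    (fusionCoeff n k l m r : ℂ) = verlinde n k l m r := by
  obtain ⟨c, hc⟩ := exists_schurBasis_mul_eq l m
  rw [fusionCoeff_eq_of_schurBasis_mul_eq hc, verlinde_eq_of_schurBasis_mul_eq hc]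

theorem schurBasis_mul (l m : Weight n k) :
    schurBasis n k l * schurBasis n k m = ∑ r, fusionCoeff n k l m r • schurBasis n k r := by
  obtain ⟨c, hc⟩ := exists_schurBasis_mul_eq l m
  simp only [fusionCoeff_eq_of_schurBasis_mul_eq hc, hc]

end Verlinde

/-! ### The fusion ring -/

section FusionRing

variable {n k : ℕ}

variable (n k) in
/-- The basis of the fusion ring consisting of the weights. -/
def FusionRing.basis : Module.Basis (Weight n k) ℤ (FusionRing n k) :=
  .ofRepr (AddEquiv.toIntLinearEquiv (AddEquiv.refl (Weight n k →₀ ℤ)))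

variable [NeZero n]

/-- The ring homomorphism from the fusion ring to the fusion algebra which sends a weight to the
class of its Schur polynomial, as an additive map. -/
def FusionRing.toAlgebra : FusionRing n k →ₗ[ℤ] FusionAlgebra n k :=
  Finsupp.linearCombination ℤ (schurBasis n k) ∘ₗ (basis n k).repr

theorem FusionRing.toAlgebra_of (m : Weight n k) : toAlgebra (of m) = schurBasis n k m :=
  (Finsupp.linearCombination_single ℤ 1 m).trans (one_smul ℤ _)

theorem FusionRing.toAlgebra_eq_sum (x : FusionRing n k) :
    toAlgebra x = ∑ m, x.coeff m • schurBasis n k m :=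
  (Finsupp.linearCombination_apply ℤ _).trans (Finsupp.sum_fintype _ _ fun _ => zero_smul ℤ _)

theorem FusionRing.toAlgebra_injective :
    Function.Injective (toAlgebra : FusionRing n k → FusionAlgebra n k) := by
  have linearIndependent_int : LinearIndependent ℤ (schurBasis n k) :=
    (schurBasis n k).linearIndependent.restrict_scalars' ℤ
  refine (injective_iff_map_eq_zero toAlgebra).2 fun x hx => Finsupp.ext fun m => ?_
  exact Fintype.linearIndependent_iff.1 linearIndependent_int x.coeff
    ((toAlgebra_eq_sum x).symm.trans hx) m

theorem FusionRing.toAlgebra_mul (x y : FusionRing n k) :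
    toAlgebra (x * y) = toAlgebra x * toAlgebra y := by
  change toAlgebra (FusionRing.mul x y) = _
  rw [toAlgebra_eq_sum x, toAlgebra_eq_sum y, Finset.sum_mul_sum]
  simp only [FusionRing.mul, map_sum, map_zsmul, toAlgebra_of, smul_mul_smul_comm, schurBasis_mul,
    Finset.smul_sum, mul_smul]

theorem FusionRing.toAlgebra_one : toAlgebra (1 : FusionRing n k) = 1 :=
  (toAlgebra_of _).trans schurBasis_vac

theorem FusionRing.isBaseChange_toAlgebra :
    IsBaseChange ℂ (toAlgebra : FusionRing n k →ₗ[ℤ] FusionAlgebra n k) :=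
  (IsBaseChange.of_basis ℤ (schurBasis n k)).comp_equiv (basis n k).repr _

variable (n k) in
/-- The isomorphism of the complexified fusion ring with the fusion algebra, as a linear map. -/
def fusionEquiv : (ℂ ⊗[ℤ] FusionRing n k) ≃ₗ[ℂ] FusionAlgebra n k :=
  FusionRing.isBaseChange_toAlgebra.equiv

theorem fusionEquiv_tmul (a : ℂ) (x : FusionRing n k) :
    fusionEquiv n k (a ⊗ₜ[ℤ] x) = a • x.toAlgebra :=
  FusionRing.isBaseChange_toAlgebra.equiv_tmul a x

theorem fusionEquiv_mul (x y : ℂ ⊗[ℤ] FusionRing n k) :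
    fusionEquiv n k (x * y) = fusionEquiv n k x * fusionEquiv n k y := by
  -- The multiplication found for `ℂ ⊗[ℤ] FusionRing n k` carries an additive structure that is not
  -- reducibly the one of the tensor product, so the distributive laws name their instance.
  induction x using TensorProduct.induction_on with
  | zero => rw [Algebra.TensorProduct.instNonUnitalNonAssocSemiring.zero_mul, map_zero, zero_mul]
  | add x x' hx hx' =>
    rw [Algebra.TensorProduct.instNonUnitalNonAssocSemiring.right_distrib, map_add, map_add, hx,
      hx', add_mul]
  | tmul a x =>
    induction y using TensorProduct.induction_on with
    | zero =>
      rw [Algebra.TensorProduct.instNonUnitalNonAssocSemiring.mul_zero, map_zero, mul_zero]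
    | add y y' hy hy' =>
      rw [Algebra.TensorProduct.instNonUnitalNonAssocSemiring.left_distrib, map_add, map_add, hy,
        hy', mul_add]
    | tmul b y =>
      rw [Algebra.TensorProduct.tmul_mul_tmul, fusionEquiv_tmul, fusionEquiv_tmul,
        fusionEquiv_tmul, FusionRing.toAlgebra_mul, smul_mul_smul_comm]

end FusionRing

end SuFusion

end

theorem mainTheorem5 (n k : ℕ) [NeZero n] :
    -- the ideal of Gepner's fusion potential is `⟨e_n - 1, h_{k+1}, …, h_{n+k-1}⟩`
    SuFusion.potentialIdeal n k = SuFusion.gepnerIdeal n k ∧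
    -- it coincides with the ideal of Goodman and Wenzl
    SuFusion.goodmanWenzlIdeal n k = SuFusion.gepnerIdeal n k ∧
    -- the Verlinde formula has integer values, and these make the fusion product
    -- a unital, commutative and associative ring structure
    (∀ l m r : SuFusion.Weight n k,
      (SuFusion.fusionCoeff n k l m r : ℂ) = SuFusion.verlinde n k l m r) ∧
    (∀ x y z : SuFusion.FusionRing n k, x * y * z = x * (y * z)) ∧
    (∀ x y : SuFusion.FusionRing n k, x * y = y * x) ∧
    (∀ x : SuFusion.FusionRing n k, 1 * x = x) ∧
    -- `λ ↦ s_λ + I_{n,k}` gives an isomorphism of algebras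
    ∃ φ : (ℂ ⊗[ℤ] SuFusion.FusionRing n k) ≃ₗ[ℂ] (SuFusion.ERing n ⧸ SuFusion.gepnerIdeal n k),
      (∀ x y, φ (x * y) = φ x * φ y) ∧
      φ (1 ⊗ₜ[ℤ] (1 : SuFusion.FusionRing n k)) = 1 ∧
      ∀ m : SuFusion.Weight n k, ∃ q : SuFusion.ERing n,
        SuFusion.IsSchur m.part q ∧
        φ (1 ⊗ₜ[ℤ] SuFusion.FusionRing.of m) =
          Ideal.Quotient.mk (SuFusion.gepnerIdeal n k) q := by
  open SuFusion FusionRing in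
  refine ⟨potentialIdeal_eq_gepnerIdeal n k, goodmanWenzlIdeal_eq_gepnerIdeal n k,
    fusionCoeff_eq_verlinde, fun x y z => toAlgebra_injective ?_,
    fun x y => toAlgebra_injective ?_, fun x => toAlgebra_injective ?_,
    fusionEquiv n k, fusionEquiv_mul, ?_, fun m => ⟨schurE (m.part + rho n), ?_, ?_⟩⟩
  · simp only [toAlgebra_mul, mul_assoc]
  · simp only [toAlgebra_mul, mul_comm]
  · rw [toAlgebra_mul, toAlgebra_one, one_mul]
  · rw [fusionEquiv_tmul, toAlgebra_one, one_smul]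
  · exact (isSchur_iff m.antitone_part _).2 rfl
  · rw [fusionEquiv_tmul, toAlgebra_of, one_smul, schurBasis_apply, schurClass]
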